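/- Conventions. A QCSP $\mathcal C$ on $d$-qudits is a finite list of clause types $H_1,\dots,H_r$, each a positive semidefinite operator on $(\mathbb C^d)^{\otimes a_i}$ (for instance a projector) for some arity $a_i$; it is $k$-local if all $a_i\le k$. An instance is a number $n$ of qudits together with a list of clauses, each given by a type $i$ and an ordered tuple of $a_i$ distinct qudits on which $H_i$ acts (tensored with the identity elsewhere). It is satisfiable (frustration-free) if some $n$-qudit state lies in the null space of all its clauses. An instance is written as a bit string: for some integer width $w\ge 1$, a self-delimiting header $0^p1^w0$ (with arbitrary padding $0^p$), followed by $n$ and, for each clause, by its type and its qudits ($1+\max_i a_i$ integers, unused ones being arbitrary), all written with $w$ binary digits. A function $f:\{0,1\}^*\to\{0,1\}^*$ reduces $\mathcal C$ to $\mathcal C'$ if it sends every string encoding an instance $I$ of $\mathcal C$ to a string encoding an instance $I'$ of $\mathcal C'$ such that $I$ is satisfiable if and only if $I'$ is, and if it respects the promise on unsatisfiable instances: there is a constant $\delta>0$, independent of $I$, such that whenever $0<\varepsilon\le 1$ and every state $\psi$ has $\sum_c\langle\psi|c|\psi\rangle\ge\varepsilon$, summed over the clauses of $I$, every state has total violation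 at least $\delta\varepsilon$ for $I'$. An $\mathsf{AC}^0$ function is one computed by a (non-uniform) family of Boolean circuits, one for each input length, of constant depth and polynomial size, with negations and with AND and OR gates of unbounded fan-in. Theorem. Let $d\ge 2$. For every QCSP $\mathcal C$ on $d$-qudits there is a QCSP $\mathcal C'$ on qubits, all of whose clauses are orthogonal projectors, and there are $\mathsf{AC}^0$ functions $f$ and $g$ such that $f$ reduces $\mathcal C$ to $\mathcal C'$ and $g$ reduces $\mathcal C'$ to $\mathcal C$. Moreover $\mathcal C'$ is such that, for every $k$ for which $\mathcal C$ is $k$-local, $\mathcal C'$ is $4\cdot 2^{\lceil\log_2\lceil\log_2 d\rceil\rceil}\,k$-local. -/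

import Mathlib

open scoped Matrix ComplexOrder

/-! ### Quantum constraint satisfaction problems -/

/-- The (unnormalised) state vectors of `n` qudits of dimension `d`, i.e. `(ℂ^d)^{⊗ n}` written in
the computational basis, whose vectors are indexed by the words `Fin n → Fin d`. -/
abbrev QuditVec (d n : ℕ) : Type := (Fin n → Fin d) → ℂ

/-- Operators on `n` qudits of dimension `d`, in the computational basis. -/
abbrev QuditOp (d n : ℕ) : Type := Matrix (Fin n → Fin d) (Fin n → Fin d) ℂ

/-- The operator `M` on `a` qudits, applied inside a system of `n` qudits: tensor factor `j` of `M`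
acts on qudit `e j`, and the identity acts on the qudits outside the range of `e`. -/
noncomputable def applyAt {d a n : ℕ} (e : Fin a ↪ Fin n) (M : QuditOp d a) : QuditOp d n :=
  open Classical in
  fun x y => if ∀ q, q ∉ Set.range e → x q = y q then M (x ∘ e) (y ∘ e) else 0

/-- A quantum constraint satisfaction problem on `d`-dimensional qudits: a finite list of clause
types, type `i` being a positive semidefinite operator on `arity i` qudits. -/
structure QCSP (d : ℕ) where
  numTypes : ℕ
  arity : Fin numTypes → ℕ
  op : (i : Fin numTypes) → QuditOp d (arity i)
  posSemidef : ∀ i, (op i).PosSemidef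

namespace QCSP

variable {d : ℕ}

/-- All clauses act on at most `k` qudits. -/
def IsLocal (C : QCSP d) (k : ℕ) : Prop := ∀ i, C.arity i ≤ k

/-- All clauses are orthogonal projectors. -/
def IsProjective (C : QCSP d) : Prop := ∀ i, IsStarProjection (C.op i)

/-- A clause in a system of `n` qudits: a clause type, and the distinct qudits it acts on,
in order. -/
structure Clause (C : QCSP d) (n : ℕ) where
  type : Fin C.numTypes
  qudits : Fin (C.arity type) ↪ Fin n

/-- The operator on the whole system that a clause stands for. -/
noncomputable def Clause.toOp {C : QCSP d} {n : ℕ} (c : C.Clause n) : QuditOp d n :=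
  applyAt c.qudits (C.op c.type)

/-- An instance: a number of qudits, and a list of clauses on them. -/
structure Instance (C : QCSP d) where
  n : ℕ
  clauses : List (C.Clause n)

/-- The total violation `∑ c, ⟨ψ| c |ψ⟩` of the clauses of an instance. -/
noncomputable def Instance.violation {C : QCSP d} (I : C.Instance) (ψ : QuditVec d I.n) : ℝ :=
  (I.clauses.map fun c => (star ψ ⬝ᵥ (c.toOp *ᵥ ψ)).re).sum

/-- Some state (unit vector) lies in the null space of every clause. -/
def Instance.Satisfiable {C : QCSP d} (I : C.Instance) : Prop :=
  ∃ ψ : QuditVec d I.n, star ψ ⬝ᵥ ψ = 1 ∧ ∀ c ∈ I.clauses, c.toOp *ᵥ ψ = 0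

/-- Every state has total violation at least `ε`. -/
def Instance.ViolatedBy {C : QCSP d} (I : C.Instance) (ε : ℝ) : Prop :=
  ∀ ψ : QuditVec d I.n, star ψ ⬝ᵥ ψ = 1 → ε ≤ I.violation ψ

/-! ### Instances as bit strings -/

/-- The `w` low-order binary digits of `v`, least significant digit first. -/
def bits (w v : ℕ) : List Bool := List.ofFn fun i : Fin w => v.testBit i

/-- The largest arity of a clause. -/
def maxArity (C : QCSP d) : ℕ := Finset.univ.sup C.arity

/-- The integers `v 0, …, v C.maxArity` describe the clause `c`: first the type, then the qudits in
order. The integers after these are not used and may be anything. -/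
def Describes (C : QCSP d) {n : ℕ} (c : C.Clause n) (v : ℕ → ℕ) : Prop :=
  v 0 = c.type ∧ ∀ j : Fin (C.arity c.type), v (j + 1) = c.qudits j

/-- The bit string `s` encodes the instance `I`: for some `p` and some integer width `w ≥ 1`, it
reads `0^p 1^w 0`, followed by the number of qudits and by `C.maxArity + 1` integers for each clause
(see `Describes`), all written with `w` binary digits. The leading zeros are padding: they allow a
circuit, whose number of outputs is fixed, to produce encodings of different lengths. -/
def Encodes (C : QCSP d) (s : List Bool) (I : C.Instance) : Prop :=
  ∃ (p w : ℕ) (v : List (ℕ → ℕ)),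
    0 < w ∧ I.n < 2 ^ w ∧ C.numTypes ≤ 2 ^ w ∧ List.Forall₂ C.Describes I.clauses v ∧
    s = List.replicate p false ++ List.replicate w true ++ [false] ++ bits w I.n ++
      v.flatMap fun r => (List.range (C.maxArity + 1)).flatMap fun j => bits w (r j)

/-- `f` reduces `C` to `C'`: it sends (encodings of) instances of `C` to instances of `C'` with the
same satisfiability. It also respects the promise under which satisfiability problems are posed: a
lower bound `ε ≤ 1` on the violation of an unsatisfiable instance carries over, up to a constant
factor. -/
def Reduces {d' : ℕ} (f : List Bool → List Bool) (C : QCSP d) (C' : QCSP d') : Prop :=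
  ∃ δ : ℝ, 0 < δ ∧ ∀ (s : List Bool) (I : C.Instance), C.Encodes s I →
    ∃ I' : C'.Instance, C'.Encodes (f s) I' ∧
      (I.Satisfiable ↔ I'.Satisfiable) ∧
      ∀ ε : ℝ, 0 < ε → ε ≤ 1 → I.ViolatedBy ε → I'.ViolatedBy (δ * ε)

end QCSP

/-! ### Constant-depth circuits -/

/-- Boolean circuits with one output, `n` inputs, negations, and conjunctions and disjunctions of
arbitrary fan-in (so the constants are the gates with `m = 0`). The circuits are trees: no gate is
shared, every use of a gate is counted in the size. (At constant depth and polynomial size this is no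
restriction, since a circuit with shared gates unfolds to a polynomially larger tree.) -/
inductive BoolCircuit (n : ℕ) : Type
  | input (i : Fin n) : BoolCircuit n
  | not (c : BoolCircuit n) : BoolCircuit n
  | and {m : ℕ} (c : Fin m → BoolCircuit n) : BoolCircuit n
  | or {m : ℕ} (c : Fin m → BoolCircuit n) : BoolCircuit n

namespace BoolCircuit

variable {n : ℕ}

/-- The value of a circuit on an input. -/
def eval (x : Fin n → Bool) : BoolCircuit n → Bool
  | input i => x i
  | not c => !(c.eval x)
  | and c => decide (∀ i, (c i).eval x = true)
  | or c => decide (∃ i, (c i).eval x = true)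

/-- The number of nodes of a circuit, inputs included. -/
def size : BoolCircuit n → ℕ
  | input _ => 1
  | not c => c.size + 1
  | and c => (∑ i, (c i).size) + 1
  | or c => (∑ i, (c i).size) + 1

/-- The largest number of gates on a path from an input to the output. -/
def depth : BoolCircuit n → ℕ
  | input _ => 0
  | not c => c.depth + 1
  | and c => (Finset.univ.sup fun i => (c i).depth) + 1
  | or c => (Finset.univ.sup fun i => (c i).depth) + 1

end BoolCircuit

/-- `f` is computed by `AC⁰` circuits: a family of circuits, one for each input length `n`, of
constant depth and of size polynomial in `n`. The circuit for length `n` has `len n` outputs, given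
by the circuits `c n j`. -/
def IsAC0 (f : List Bool → List Bool) : Prop :=
  ∃ (D : ℕ) (P : Polynomial ℕ) (len : ℕ → ℕ) (c : (n : ℕ) → Fin (len n) → BoolCircuit n),
    (∀ n j, (c n j).depth ≤ D) ∧
    (∀ n, ∑ j, (c n j).size ≤ P.eval n) ∧
    ∀ (n : ℕ) (x : Fin n → Bool), f (List.ofFn x) = List.ofFn fun j => (c n j).eval x

/-! Each qudit is encoded in a block of N qubits by an isometry V. A clause type H with range
projector P becomes `encProj V P`, the projector whose kernel is the image of ker P under the tensor
power of V. It tests P and, at the same time, whether every block lies in the code space.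

The difficulty is the way back: an instance of the qubit problem may place its blocks anywhere,
overlapping and misaligned. The code is therefore chosen rigid (`exists_rigid_code`): no nonzero
state is a code state on two different blocks (as ordered tuples) that share a qubit. An instance
with such a clash is unsatisfiable (`noOverlap_of_satisfiable`) and can be sent to a fixed
unsatisfiable instance of the qudit problem. Without a clash it consists of disjoint blocks
(`exists_blocks_of_noOverlap`), and each block is read as one qudit named by its first qubit. If
every instance of the given problem is satisfiable, the problem without clause types and constant
maps suffice.

Rigidity is a genericity argument. For one overlap pattern of two blocks it says that a certain
determinant, polynomial in the entries of a real matrix W spanning the code, is nonzero. There are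
finitely many patterns and each has its own explicit W (`exists_code_of_isOverlap`), so the product
of the determinants is a nonzero polynomial and some W works for all patterns
(`exists_generic_code`).

For the promise, violation at least ε means ε · 1 ≤ total in the Loewner order
(`Instance.violatedBy_iff`). H and P are comparable up to a constant. Compressing by the tensor
power of V carries bounds from qubits to qudits (`le_totalAt_of_le_encProj`). Conversely, `decoder`
decodes each block separately, keeping a record of failures, and the decoded clause is at most the
encoded one (`compress_fstOp_le_encProj`). Satisfiability follows from these bounds by compactness.

Both maps are `AC⁰` because, once the header is known, each output bit is a constant or a copy of an
input bit, chosen also by the clash test in the decoding direction. For the encoding this uses that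
N is a power of two: qubit addresses are qudit addresses followed by constant low bits. -/

set_option linter.unusedSectionVars false

/-! ### Operators acting on some of the factors of a tensor power -/

section LocalOp

open Matrix Kronecker

variable {κ ι μ α β γ R : Type*}

/-- The operator `M` on the tensor factors indexed by `κ`, applied to the factors `e j` of a system
indexed by `ι` whose factors have the alphabet `α` as a basis. -/
noncomputable def localOp [Zero R] (e : κ ↪ ι) (M : Matrix (κ → α) (κ → α) R) :
    Matrix (ι → α) (ι → α) R :=
  open Classical in
  fun x y => if ∀ q, q ∉ Set.range e → x q = y q then M (x ∘ e) (y ∘ e) else 0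

theorem applyAt_eq_localOp {d a n : ℕ} (e : Fin a ↪ Fin n) (M : QuditOp d a) :
    applyAt e M = localOp e M := by
  ext x y
  simp only [applyAt, localOp]
  congr

/-- A word indexed by `ι` splits into its letters in the range of `e` and the others. -/
noncomputable def splitEquiv (e : κ ↪ ι) (α : Type*) :
    (ι → α) ≃ (κ → α) × ({q // q ∉ Set.range e} → α) where
  toFun x := (x ∘ e, fun q => x q)
  invFun p := open Classical in fun q => if h : q ∈ Set.range e then p.1 h.choose else p.2 ⟨q, h⟩
  left_inv x := by
    funext q
    by_cases h : q ∈ Set.range e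
    · simp only [h, dite_true, Function.comp_apply, h.choose_spec]
    · simp only [h, dite_false]
  right_inv p := by
    refine Prod.ext (funext fun k => ?_) (funext fun q => ?_)
    · have h : e k ∈ Set.range e := ⟨k, rfl⟩
      simp only [Function.comp_apply, h, dite_true]
      rw [e.injective h.choose_spec]
    · simp only [q.2, dite_false]

@[simp] theorem splitEquiv_fst (e : κ ↪ ι) (x : ι → α) : (splitEquiv e α x).1 = x ∘ e := rfl

@[simp] theorem splitEquiv_snd (e : κ ↪ ι) (x : ι → α) (q) : (splitEquiv e α x).2 q = x q := rfl

/-- After reordering the factors, a local operator is a Kronecker product with an identity;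
multiplicativity and positivity are inherited from there. -/
theorem localOp_eq_submatrix [NonAssocSemiring R] (e : κ ↪ ι)
    [DecidableEq ({q // q ∉ Set.range e} → α)] (M : Matrix (κ → α) (κ → α) R) :
    localOp e M = (M ⊗ₖ (1 : Matrix ({q // q ∉ Set.range e} → α) _ R)).submatrix
      (splitEquiv e α) (splitEquiv e α) := by
  ext x y
  have : ((splitEquiv e α x).2 = (splitEquiv e α y).2) ↔ ∀ q, q ∉ Set.range e → x q = y q := by
    simp [funext_iff]
  simp only [localOp, submatrix_apply, kroneckerMap_apply, one_apply, splitEquiv_fst]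
  by_cases h : ∀ q, q ∉ Set.range e → x q = y q
  · rw [if_pos h, if_pos (this.2 h), mul_one]
  · rw [if_neg h, if_neg (mt this.1 h), mul_zero]

theorem localOp_zero [Zero R] (e : κ ↪ ι) :
    localOp e (0 : Matrix (κ → α) (κ → α) R) = 0 := by
  ext x y; simp [localOp]

theorem localOp_add [AddZeroClass R] (e : κ ↪ ι) (M M' : Matrix (κ → α) (κ → α) R) :
    localOp e (M + M') = localOp e M + localOp e M' := by
  ext x y; simp only [localOp, Matrix.add_apply]; split_ifs <;> simp

theorem localOp_sub [AddGroup R] (e : κ ↪ ι) (M M' : Matrix (κ → α) (κ → α) R) :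
    localOp e (M - M') = localOp e M - localOp e M' := by
  ext x y; simp only [localOp, Matrix.sub_apply]; split_ifs <;> simp

theorem localOp_smul {S : Type*} [Zero R] [SMulZeroClass S R] (e : κ ↪ ι) (c : S)
    (M : Matrix (κ → α) (κ → α) R) : localOp e (c • M) = c • localOp e M := by
  ext x y; simp only [localOp, Matrix.smul_apply]; split_ifs <;> simp

theorem localOp_map {S : Type*} [Zero R] [Zero S] (e : κ ↪ ι) (f : R → S) (hf : f 0 = 0)
    (M : Matrix (κ → α) (κ → α) R) : localOp e (M.map f) = (localOp e M).map f := by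
  ext x y; simp only [localOp, map_apply]; split_ifs <;> simp [hf]

theorem localOp_localOp [Zero R] (e : κ ↪ ι) (f : ι ↪ μ) (M : Matrix (κ → α) (κ → α) R) :
    localOp f (localOp e M) = localOp (e.trans f) M := by
  classical
  ext x y
  simp only [localOp]
  rw [← ite_and]
  refine if_congr ⟨fun h q hq => ?_, fun h => ⟨fun q hq => h q ?_, fun q hq => h _ ?_⟩⟩ rfl rfl
  · by_cases h' : q ∈ Set.range f
    · obtain ⟨i, rfl⟩ := h'
      refine h.2 i ?_
      rintro ⟨k, rfl⟩
      exact hq ⟨k, rfl⟩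
    · exact h.1 q h'
  · rintro ⟨k, rfl⟩; exact hq ⟨_, rfl⟩
  · rintro ⟨k, hk⟩; exact hq ⟨k, f.injective hk⟩

section Finite

variable [Fintype κ] [DecidableEq κ] [Fintype ι] [DecidableEq ι] [Fintype α] [DecidableEq α]
  [Fintype β] [DecidableEq β]

theorem localOp_one [NonAssocSemiring R] (e : κ ↪ ι) :
    localOp e (1 : Matrix (κ → α) (κ → α) R) = 1 := by
  classical
  ext x y
  simp only [localOp, one_apply]
  rw [← ite_and]
  refine if_congr ⟨fun h => funext fun q => ?_, fun h => by simp [h]⟩ rfl rfl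
  by_cases h' : q ∈ Set.range e
  · obtain ⟨i, rfl⟩ := h'
    exact congrFun h.2 i
  · exact h.1 q h'

theorem localOp_mul [CommSemiring R] (e : κ ↪ ι) (M M' : Matrix (κ → α) (κ → α) R) :
    localOp e (M * M') = localOp e M * localOp e M' := by
  classical
  rw [localOp_eq_submatrix, localOp_eq_submatrix, localOp_eq_submatrix, submatrix_mul_equiv,
    ← mul_kronecker_mul, Matrix.one_mul]

theorem localOp_posSemidef {M : Matrix (κ → α) (κ → α) ℂ} (e : κ ↪ ι) (hM : M.PosSemidef) :
    (localOp e M).PosSemidef := by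
  classical
  rw [localOp_eq_submatrix]
  exact (hM.kronecker PosSemidef.one).submatrix _

/-- Fixing all letters outside `e` exhibits `M` as a principal submatrix; a letter to fix them at is
needed. -/
theorem posSemidef_of_localOp [Nonempty α] {M : Matrix (κ → α) (κ → α) ℂ} (e : κ ↪ ι)
    (hM : (localOp e M).PosSemidef) : M.PosSemidef := by
  classical
  obtain ⟨c⟩ := ‹Nonempty α›
  convert hM.submatrix (fun x => (splitEquiv e α).symm (x, fun _ => c)) using 1
  rw [localOp_eq_submatrix]
  ext x y
  simp

/-- The entries of `localOp e M *ᵥ ψ`, where `Function.extend e x z` is the word `z` with the letters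
at `e` overwritten by `x`. -/
theorem localOp_mulVec_apply [CommSemiring R] (e : κ ↪ ι) (M : Matrix (κ → α) (κ → α) R)
    (ψ : (ι → α) → R) (z : ι → α) :
    (localOp e M *ᵥ ψ) z = ∑ x, M (z ∘ e) x * ψ (Function.extend e x z) := by
  classical
  have hext : ∀ x : κ → α, (splitEquiv e α).symm (x, (splitEquiv e α z).2) =
      Function.extend e x z := by
    intro x
    rw [Equiv.symm_apply_eq]
    refine Prod.ext (funext fun k => ?_) (funext fun q => ?_)
    · simp [e.injective.extend_apply]
    · rw [splitEquiv_snd, splitEquiv_snd, Function.extend_apply' _ _ _ q.2]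
  simp only [mulVec, dotProduct]
  rw [← (splitEquiv e α).symm.sum_comp, Fintype.sum_prod_type]
  refine Finset.sum_congr rfl fun x _ => ?_
  rw [Finset.sum_eq_single (splitEquiv e α z).2]
  · rw [hext, localOp, if_pos]
    · congr 2
      funext k
      simp [e.injective.extend_apply]
    · intro q hq
      rw [Function.extend_apply' _ _ _ hq]
  · intro y _ hy
    rw [localOp_eq_submatrix]
    simp [one_apply, Ne.symm hy]
  · simp

/-- A local operator acts separately on each slice of the state obtained by freezing the letters
outside `e`. -/
theorem localOp_mulVec_eq_zero_iff [CommSemiring R] (e : κ ↪ ι) (M : Matrix (κ → α) (κ → α) R)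
    (ψ : (ι → α) → R) :
    localOp e M *ᵥ ψ = 0 ↔ ∀ z : ι → α, M *ᵥ (fun x => ψ (Function.extend e x z)) = 0 := by
  constructor
  · intro h z
    funext x0
    have := congrFun h (Function.extend e x0 z)
    rw [localOp_mulVec_apply] at this
    refine Eq.trans ?_ this
    refine Finset.sum_congr rfl fun x _ => ?_
    have h1 : Function.extend e x0 z ∘ e = x0 := by
      funext k; simp [e.injective.extend_apply]
    have h2 : Function.extend e x (Function.extend e x0 z) = Function.extend e x z := by
      funext q
      by_cases hq : ∃ k, e k = q
      · obtain ⟨k, rfl⟩ := hq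
        simp [e.injective.extend_apply]
      · rw [Function.extend_apply' _ _ _ hq, Function.extend_apply' _ _ _ hq,
          Function.extend_apply' _ _ _ hq]
    rw [h1, h2]
  · intro h
    funext z
    rw [localOp_mulVec_apply]
    exact congrFun (h z) (z ∘ e)

end Finite

end LocalOp

/-! ### Tensor powers of a matrix -/

section TensorPow

open Matrix Kronecker

variable {κ ι α β γ : Type*} [Fintype κ] [DecidableEq κ] [Fintype ι] [DecidableEq ι]
  [Fintype α] [DecidableEq α] [Fintype β] [DecidableEq β] [Fintype γ] [DecidableEq γ]

/-- The tensor power of `A` with factors indexed by `ι`. -/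
def tensorPow (ι : Type*) [Fintype ι] (A : Matrix α β ℂ) : Matrix (ι → α) (ι → β) ℂ :=
  fun x y => ∏ i, A (x i) (y i)

theorem tensorPow_mul (A : Matrix α β ℂ) (B : Matrix β γ ℂ) :
    tensorPow ι (A * B) = tensorPow ι A * tensorPow ι B := by
  ext x y
  simp only [tensorPow, mul_apply, ← Finset.prod_mul_distrib]
  exact Fintype.prod_sum _

theorem tensorPow_one : tensorPow ι (1 : Matrix α α ℂ) = 1 := by
  ext x y
  simp only [tensorPow, one_apply]
  by_cases h : x = y
  · simp [h]
  · rw [if_neg h]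
    obtain ⟨i, hi⟩ := Function.ne_iff.1 h
    exact Finset.prod_eq_zero (Finset.mem_univ i) (if_neg hi)

theorem tensorPow_conjTranspose (A : Matrix α β ℂ) :
    (tensorPow ι A)ᴴ = tensorPow ι Aᴴ := by
  ext x y
  simp [tensorPow, conjTranspose_apply]

theorem tensorPow_isometry {A : Matrix α β ℂ} (hA : Aᴴ * A = 1) :
    (tensorPow ι A)ᴴ * tensorPow ι A = 1 := by
  rw [tensorPow_conjTranspose, ← tensorPow_mul, hA, tensorPow_one]

theorem tensorPow_eq_submatrix (e : κ ↪ ι) [Fintype {q // q ∉ Set.range e}] (A : Matrix α β ℂ) :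
    tensorPow ι A = (tensorPow κ A ⊗ₖ tensorPow {q // q ∉ Set.range e} A).submatrix
      (splitEquiv e α) (splitEquiv e β) := by
  ext x y
  simp only [tensorPow, submatrix_apply, kroneckerMap_apply, splitEquiv_fst, splitEquiv_snd,
    Function.comp_apply]
  classical
  rw [← Fintype.prod_subtype_mul_prod_subtype (fun q => q ∈ Set.range e)]
  congr 1
  · symm
    exact (Fintype.prod_equiv (Equiv.ofInjective e e.injective) _
      (fun q : Set.range e => A (x q) (y q)) fun _ => rfl).trans
        (Finset.prod_congr (by ext; simp) fun _ _ => rfl)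
  · exact Finset.prod_congr (by ext; simp) fun _ _ => rfl

/-- A local operator, compressed by a tensor power of an isometry. -/
theorem tensorPow_compress {A : Matrix α β ℂ} (hA : Aᴴ * A = 1) (e : κ ↪ ι)
    (M : Matrix (κ → α) (κ → α) ℂ) :
    (tensorPow ι A)ᴴ * localOp e M * tensorPow ι A =
      localOp e ((tensorPow κ A)ᴴ * M * tensorPow κ A) := by
  classical
  rw [localOp_eq_submatrix, localOp_eq_submatrix, tensorPow_eq_submatrix e A,
    conjTranspose_submatrix, submatrix_mul_equiv, submatrix_mul_equiv, conjTranspose_kronecker,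
    ← mul_kronecker_mul, ← mul_kronecker_mul, Matrix.mul_one, tensorPow_isometry hA]

end TensorPow

/-! ### The Loewner order, range projectors and encoded projectors -/

section Loewner

open Matrix Kronecker Filter Topology
open scoped MatrixOrder

theorem IsStarProjection.posSemidef {n : Type*} [Fintype n] {P : Matrix n n ℂ}
    (hP : IsStarProjection P) : P.PosSemidef := by
  have h : P = Pᴴ * P := by
    have h1 : Pᴴ = P := hP.isSelfAdjoint
    rw [h1]
    exact hP.isIdempotentElem.symm
  rw [h]
  exact posSemidef_conjTranspose_mul_self P

theorem compress_le {m n : Type*} [Fintype m] [Fintype n] {A B : Matrix n n ℂ} (h : A ≤ B)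
    (X : Matrix n m ℂ) : Xᴴ * A * X ≤ Xᴴ * B * X := by
  rw [Matrix.le_iff] at h ⊢
  have := h.conjTranspose_mul_mul_same X
  rwa [Matrix.mul_sub, Matrix.sub_mul] at this

/-- The projector onto the range of a positive semidefinite matrix is comparable to it. -/
theorem exists_rangeProj {n : Type*} [Fintype n] {H : Matrix n n ℂ}
    (hH : H.PosSemidef) : ∃ P : Matrix n n ℂ, IsStarProjection P ∧
      ∀ᶠ c : ℝ in 𝓝[>] 0, (c : ℂ) • H ≤ P ∧ (c : ℂ) • P ≤ H := by
  classical
  set lam := hH.isHermitian.eigenvalues with hlam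
  set U : Matrix n n ℂ := (hH.isHermitian.eigenvectorUnitary : Matrix n n ℂ) with hU
  have hUU : Uᴴ * U = 1 := (Unitary.mem_iff.1 hH.isHermitian.eigenvectorUnitary.2).1
  have hspec : H = U * diagonal (fun i => (lam i : ℂ)) * Uᴴ := by
    have := hH.isHermitian.spectral_theorem
    rw [Unitary.conjStarAlgAut_apply] at this
    exact this
  -- In an eigenbasis of `H` the projector is the indicator of the nonzero eigenvalues, so both
  -- inequalities are statements about single eigenvalues.
  set p : n → ℂ := fun i => if lam i = 0 then 0 else 1 with hp
  have hdiag : ∀ a b : n → ℂ, (∀ i, a i ≤ b i) →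
      U * diagonal a * Uᴴ ≤ U * diagonal b * Uᴴ := by
    intro a b hab
    have h1 : diagonal a ≤ diagonal b := by
      rw [Matrix.le_iff, diagonal_sub, posSemidef_diagonal_iff]
      exact fun i => sub_nonneg.2 (hab i)
    simpa using compress_le h1 Uᴴ
  refine ⟨U * diagonal p * Uᴴ, ⟨?_, ?_⟩, ?_⟩
  · show U * diagonal p * Uᴴ * (U * diagonal p * Uᴴ) = _
    have : U * diagonal p * Uᴴ * (U * diagonal p * Uᴴ) =
        U * (diagonal p * (Uᴴ * U) * diagonal p) * Uᴴ := by simp only [Matrix.mul_assoc]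
    rw [this, hUU, Matrix.mul_one, diagonal_mul_diagonal]
    congr 3
    funext i
    simp only [hp]
    split_ifs <;> simp
  · show (U * diagonal p * Uᴴ)ᴴ = _
    rw [conjTranspose_mul, conjTranspose_mul, conjTranspose_conjTranspose, diagonal_conjTranspose,
      Matrix.mul_assoc]
    congr 3
    funext i
    simp only [hp, Pi.star_apply]
    split_ifs <;> simp
  · have hev : ∀ᶠ c in 𝓝[>] (0 : ℝ), ∀ i, c * lam i ≤ 1 ∧ (lam i ≠ 0 → c ≤ lam i) := by
      rw [eventually_all]
      intro i
      have h0 : 0 ≤ lam i := hH.eigenvalues_nonneg i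
      refine Eventually.and ?_ ?_
      · have : Tendsto (fun c : ℝ => c * lam i) (𝓝[>] 0) (𝓝 (0 * lam i)) :=
          ((continuous_id.mul continuous_const).tendsto 0).mono_left nhdsWithin_le_nhds
        rw [zero_mul] at this
        exact this.eventually_le_const one_pos
      · by_cases h : lam i = 0
        · simp [h]
        · have hpos : 0 < lam i := lt_of_le_of_ne h0 (Ne.symm h)
          filter_upwards [(eventually_le_nhds hpos).filter_mono nhdsWithin_le_nhds] with c hc _
          exact hc
    filter_upwards [hev, self_mem_nhdsWithin] with c hc hc0
    have hsm : ∀ a : n → ℂ, (c : ℂ) • (U * diagonal a * Uᴴ) =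
        U * diagonal (fun i => (c : ℂ) * a i) * Uᴴ := by
      intro a
      rw [← Matrix.smul_mul, ← Matrix.mul_smul, ← diagonal_smul]
      rfl
    constructor
    · rw [hspec, hsm]
      refine hdiag _ _ fun i => ?_
      simp only [hp]
      split_ifs with h
      · simp [h]
      · exact_mod_cast (hc i).1
    · rw [hsm]
      conv_rhs => rw [hspec]
      refine hdiag _ _ fun i => ?_
      simp only [hp]
      split_ifs with h
      · simp [h]
      · simpa using (hc i).2 h

variable {κ ι α β : Type*} [Fintype κ] [DecidableEq κ] [Fintype ι] [DecidableEq ι]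
  [Fintype α] [DecidableEq α] [Fintype β] [DecidableEq β]

theorem localOp_mono {A B : Matrix (κ → α) (κ → α) ℂ} (e : κ ↪ ι) (h : A ≤ B) :
    localOp e A ≤ localOp e B := by
  rw [Matrix.le_iff] at h ⊢
  rw [← localOp_sub]
  exact localOp_posSemidef e h

/-! ### Encoded projectors -/

/-- The projector onto the orthogonal complement of the image of the kernel of `P` under the tensor
power of the isometry `V`. -/
def encProj (V : Matrix α β ℂ) (P : Matrix (κ → β) (κ → β) ℂ) : Matrix (κ → α) (κ → α) ℂ :=
  1 - tensorPow κ V * (1 - P) * (tensorPow κ V)ᴴ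

theorem encProj_isStarProjection {V : Matrix α β ℂ} (hV : Vᴴ * V = 1)
    {P : Matrix (κ → β) (κ → β) ℂ} (hP : IsStarProjection P) :
    IsStarProjection (encProj V P) := by
  refine IsStarProjection.one_sub ⟨?_, ?_⟩
  · show _ * _ = _
    have h1 := tensorPow_isometry (ι := κ) hV
    have h2 : (1 - P) * (1 - P) = 1 - P := hP.one_sub.isIdempotentElem
    calc tensorPow κ V * (1 - P) * (tensorPow κ V)ᴴ * (tensorPow κ V * (1 - P) * (tensorPow κ V)ᴴ)
        = tensorPow κ V * (1 - P) * ((tensorPow κ V)ᴴ * tensorPow κ V) * (1 - P) *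
          (tensorPow κ V)ᴴ := by simp only [Matrix.mul_assoc]
      _ = tensorPow κ V * ((1 - P) * (1 - P)) * (tensorPow κ V)ᴴ := by
          rw [h1, Matrix.mul_one, Matrix.mul_assoc (tensorPow κ V)]
      _ = _ := by rw [h2]
  · show (tensorPow κ V * (1 - P) * (tensorPow κ V)ᴴ)ᴴ = _
    have h3 : (1 - P)ᴴ = 1 - P := hP.one_sub.isSelfAdjoint
    rw [conjTranspose_mul, conjTranspose_mul, conjTranspose_conjTranspose, h3, Matrix.mul_assoc]

/-- On code states the encoded projector is just `P`: the code space test contributes nothing there.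
-/
theorem encProj_compress {V : Matrix α β ℂ} (hV : Vᴴ * V = 1) (P : Matrix (κ → β) (κ → β) ℂ) :
    (tensorPow κ V)ᴴ * encProj V P * tensorPow κ V = P := by
  have h1 := tensorPow_isometry (ι := κ) hV
  rw [encProj, Matrix.mul_sub, Matrix.sub_mul, Matrix.mul_one, h1]
  have : (tensorPow κ V)ᴴ * (tensorPow κ V * (1 - P) * (tensorPow κ V)ᴴ) * tensorPow κ V =
      ((tensorPow κ V)ᴴ * tensorPow κ V) * (1 - P) * ((tensorPow κ V)ᴴ * tensorPow κ V) := by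
    simp only [Matrix.mul_assoc]
  rw [this, h1]
  simp

/-- A word over pairs is a pair of words. -/
def pairEquiv (κ β γ : Type*) : (κ → β × γ) ≃ (κ → β) × (κ → γ) :=
  Equiv.arrowProdEquivProdArrow κ (fun _ => β) (fun _ => γ)

/-- The operator `M` on the first components of the letters. -/
def fstOp (γ : Type*) [DecidableEq γ] (M : Matrix (κ → β) (κ → β) ℂ) :
    Matrix (κ → β × γ) (κ → β × γ) ℂ :=
  (M ⊗ₖ (1 : Matrix (κ → γ) (κ → γ) ℂ)).submatrix (pairEquiv κ β γ) (pairEquiv κ β γ)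

theorem fstOp_localOp {γ : Type*} [Fintype γ] [DecidableEq γ] (e : κ ↪ ι)
    (M : Matrix (κ → β) (κ → β) ℂ) : fstOp γ (localOp e M) = localOp e (fstOp γ M) := by
  classical
  ext x y
  simp only [fstOp, localOp, submatrix_apply, kroneckerMap_apply, one_apply, pairEquiv,
    Equiv.arrowProdEquivProdArrow, Equiv.coe_fn_mk]
  have key : ((∀ q, q ∉ Set.range e → (x q).1 = (y q).1) ∧ (fun i => (x i).2) = fun i => (y i).2) ↔
      (∀ q, q ∉ Set.range e → x q = y q) ∧ (fun i => ((x ∘ e) i).2) = fun i => ((y ∘ e) i).2 := by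
    constructor
    · rintro ⟨h1, h2⟩
      exact ⟨fun q hq => Prod.ext (h1 q hq) (congrFun h2 q), funext fun i => congrFun h2 (e i)⟩
    · rintro ⟨h1, h2⟩
      refine ⟨fun q hq => by rw [h1 q hq], funext fun q => ?_⟩
      by_cases hq : q ∈ Set.range e
      · obtain ⟨i, rfl⟩ := hq
        exact congrFun h2 i
      · rw [h1 q hq]
  have hl : ∀ (a b : Prop) [Decidable a] [Decidable b] (z : ℂ),
      (if a then z else 0) * (if b then 1 else 0) = if a ∧ b then z else 0 := by
    intro a b _ _ z
    by_cases ha : a <;> by_cases hb : b <;> simp [ha, hb]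
  have hl' : ∀ (a b : Prop) [Decidable a] [Decidable b] (z : ℂ),
      (if a then z * (if b then 1 else 0) else 0) = if a ∧ b then z else 0 := by
    intro a b _ _ z
    by_cases ha : a <;> by_cases hb : b <;> simp [ha, hb]
  have hc : ∀ {a b : Prop} {_ : Decidable a} {_ : Decidable b} (z : ℂ), (a ↔ b) →
      (if a then z else 0) = if b then z else 0 := by
    intro a b _ _ z hab
    by_cases ha : a <;> simp [ha, ← hab]
  rw [hl, hl']
  exact hc _ key

theorem fstOp_add {γ : Type*} [DecidableEq γ] (M M' : Matrix (κ → β) (κ → β) ℂ) :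
    fstOp γ (M + M') = fstOp γ M + fstOp γ M' := by
  simp only [fstOp, add_kronecker, submatrix_add, Pi.add_apply]

theorem fstOp_zero {γ : Type*} [DecidableEq γ] :
    fstOp γ (0 : Matrix (κ → β) (κ → β) ℂ) = 0 := by
  simp only [fstOp, zero_kronecker, submatrix_zero, Pi.zero_apply]

theorem fstOp_smul_one {γ : Type*} [DecidableEq γ] (c : ℂ) :
    fstOp γ (c • (1 : Matrix (κ → β) (κ → β) ℂ)) = c • 1 := by
  rw [fstOp, smul_kronecker, one_kronecker_one, submatrix_smul]
  simp

theorem fstOp_mono {γ : Type*} [Fintype γ] [DecidableEq γ] {A B : Matrix (κ → β) (κ → β) ℂ}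
    (h : A ≤ B) : fstOp γ A ≤ fstOp γ B := by
  rw [Matrix.le_iff] at h ⊢
  have : fstOp γ B = fstOp γ (B - A) + fstOp γ A := by rw [← fstOp_add, sub_add_cancel]
  rw [this, add_sub_cancel_right]
  exact (h.kronecker PosSemidef.one).submatrix _

/-- An isometry on `α` that decodes the range of `V`, and sends its orthogonal complement to a fixed
letter, keeping a record. -/
def decoder (V : Matrix α β ℂ) (b₀ : β) : Matrix (β × Option α) α ℂ :=
  fun y x => match y.2 with
    | none => Vᴴ y.1 x
    | some u => if y.1 = b₀ then (1 - V * Vᴴ : Matrix α α ℂ) u x else 0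

theorem decoder_isometry {V : Matrix α β ℂ} (hV : Vᴴ * V = 1) (b₀ : β) :
    (decoder V b₀)ᴴ * decoder V b₀ = 1 := by
  have hproj : (1 - V * Vᴴ : Matrix α α ℂ)ᴴ * (1 - V * Vᴴ) = 1 - V * Vᴴ := by
    have h1 : V * Vᴴ * (V * Vᴴ) = V * Vᴴ := by
      rw [Matrix.mul_assoc, ← Matrix.mul_assoc Vᴴ, hV, Matrix.one_mul]
    have h2 : (1 - V * Vᴴ)ᴴ = 1 - V * Vᴴ := by simp
    rw [h2, Matrix.mul_sub, Matrix.sub_mul, Matrix.sub_mul, h1]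
    simp
  have key : (decoder V b₀)ᴴ * decoder V b₀ = V * Vᴴ + (1 - V * Vᴴ : Matrix α α ℂ)ᴴ * (1 - V * Vᴴ) := by
    ext x x'
    rw [Matrix.add_apply]
    simp only [Matrix.mul_apply, conjTranspose_apply, decoder]
    rw [Fintype.sum_prod_type_right, Fintype.sum_option]
    congr 1
    · simp
    · refine Finset.sum_congr rfl fun u _ => ?_
      rw [Finset.sum_eq_single b₀] <;> simp +contextual
  rw [key, hproj]
  simp

/-- Where all records are `none`, decoding inverts the tensor power of `V`; so `1 - encProj V P` is
the compression of `1 - P` tensored with the projector `O` onto those records. Replacing `O` by the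
identity only enlarges it, and taking complements gives the inequality. -/
theorem compress_fstOp_le_encProj {V : Matrix α β ℂ} (hV : Vᴴ * V = 1) (b₀ : β)
    {P : Matrix (κ → β) (κ → β) ℂ} (hP : IsStarProjection P) :
    (tensorPow κ (decoder V b₀))ᴴ * fstOp (Option α) P * tensorPow κ (decoder V b₀) ≤
      encProj V P := by
  classical
  set J := tensorPow κ (decoder V b₀) with hJ
  set E := pairEquiv κ β (Option α) with hE
  set O : Matrix (κ → Option α) (κ → Option α) ℂ :=
    diagonal fun k => if k = fun _ => none then 1 else 0 with hO
  have h1 : Jᴴ * fstOp (Option α) (1 : Matrix (κ → β) (κ → β) ℂ) * J =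
      (1 : Matrix (κ → α) (κ → α) ℂ) := by
    rw [← one_smul ℂ (1 : Matrix (κ → β) (κ → β) ℂ), fstOp_smul_one, one_smul, Matrix.mul_one]
    exact tensorPow_isometry (decoder_isometry hV b₀)
  have h2 : tensorPow κ V * (1 - P) * (tensorPow κ V)ᴴ =
      Jᴴ * ((1 - P) ⊗ₖ O).submatrix E E * J := by
    -- The rows of `J` whose records are all `none` form the adjoint of the tensor power of `V`.
    have hR : (tensorPow κ V)ᴴ =
        (of fun (y : κ → β) (y' : (κ → β) × (κ → Option α)) =>
          if y' = (y, fun _ => none) then (1 : ℂ) else 0).submatrix id E * J := by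
      ext y x
      rw [Matrix.mul_apply, Finset.sum_eq_single (E.symm (y, fun _ => none))]
      · simp [hJ, tensorPow, decoder, E, pairEquiv, Equiv.arrowProdEquivProdArrow]
      · intro z _ hz
        have : E z ≠ (y, fun _ => none) := fun h => hz (by rw [← h, Equiv.symm_apply_apply])
        simp [this]
      · simp
    have hR' : tensorPow κ V = ((tensorPow κ V)ᴴ)ᴴ := (conjTranspose_conjTranspose _).symm
    rw [hR', conjTranspose_conjTranspose (tensorPow κ V)ᴴ, hR, conjTranspose_mul]
    set R : Matrix (κ → β) ((κ → β) × (κ → Option α)) ℂ :=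
      (of fun (y : κ → β) (y' : (κ → β) × (κ → Option α)) =>
          if y' = (y, fun _ => none) then (1 : ℂ) else 0) with hRdef
    have h3 : (1 - P) ⊗ₖ O = Rᴴ * (1 - P) * R := by
      ext ⟨a, k⟩ ⟨a', k'⟩
      simp only [kroneckerMap_apply, Matrix.mul_apply, hRdef, conjTranspose_apply, of_apply, hO,
        diagonal_apply, Prod.mk.injEq]
      by_cases hk : k = fun _ => none
      · by_cases hk' : k' = fun _ => none
        · simp [hk, hk']
        · simp [hk, hk', Ne.symm hk']
      · by_cases hk' : k' = fun _ => none
        · simp [hk, hk']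
        · simp [hk, hk']
    rw [h3, conjTranspose_submatrix]
    have h4 : (Rᴴ * (1 - P) * R).submatrix E E =
        Rᴴ.submatrix E id * (1 - P) * R.submatrix id E := rfl
    rw [h4]
    simp only [Matrix.mul_assoc]
  have h5 : ((1 - P) ⊗ₖ O).submatrix E E ≤ fstOp (Option α) (1 - P) := by
    rw [Matrix.le_iff, fstOp]
    have h6 : (((1 - P) ⊗ₖ (1 : Matrix (κ → Option α) (κ → Option α) ℂ)).submatrix E E -
        ((1 - P) ⊗ₖ O).submatrix E E) = ((1 - P) ⊗ₖ (1 - O)).submatrix E E := by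
      ext x y
      simp [kroneckerMap_apply, mul_sub]
    rw [h6]
    refine (hP.one_sub.posSemidef.kronecker ?_).submatrix _
    rw [hO, ← diagonal_one, diagonal_sub, posSemidef_diagonal_iff]
    intro k
    split_ifs <;> simp
  have h7 := compress_le h5 J
  rw [← h2] at h7
  rw [encProj, ← h1]
  have h8 : fstOp (Option α) (1 : Matrix (κ → β) (κ → β) ℂ) =
      fstOp (Option α) (1 - P) + fstOp (Option α) P := by rw [← fstOp_add, sub_add_cancel]
  rw [h8, Matrix.mul_add, Matrix.add_mul, add_sub_right_comm]
  exact le_add_of_nonneg_left (sub_nonneg.2 h7)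

/-- The local operator Y is a projector whose compression by the tensor power of `V` is zero. That
compression is the Gram matrix of the product, so the product itself vanishes. The index type `Unit`
lets a single factor be treated by the tensor power lemmas. -/
theorem localOp_compl_mul_tensorPow {V : Matrix α β ℂ} (hV : Vᴴ * V = 1) (e : Unit ↪ ι) :
    localOp e (1 - tensorPow Unit V * (tensorPow Unit V)ᴴ) * tensorPow ι V = 0 := by
  have hu := tensorPow_isometry (ι := Unit) hV
  set X := 1 - tensorPow Unit V * (tensorPow Unit V)ᴴ with hX
  have hXh : Xᴴ = X := by simp [hX]
  have hXX : X * X = X := by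
    have h1 : tensorPow Unit V * (tensorPow Unit V)ᴴ * (tensorPow Unit V * (tensorPow Unit V)ᴴ) =
        tensorPow Unit V * (tensorPow Unit V)ᴴ := by
      rw [Matrix.mul_assoc, ← Matrix.mul_assoc (tensorPow Unit V)ᴴ, hu, Matrix.one_mul]
    rw [hX, Matrix.mul_sub, Matrix.sub_mul, Matrix.sub_mul, h1]
    simp
  have hXV : (tensorPow Unit V)ᴴ * X * tensorPow Unit V = 0 := by
    rw [hX, Matrix.mul_sub, Matrix.sub_mul, Matrix.mul_one, ← Matrix.mul_assoc, hu, Matrix.one_mul,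
      hu, sub_self]
  have hc := tensorPow_compress hV e X
  rw [hXV, localOp_zero] at hc
  have hYh : (localOp e X)ᴴ = localOp e X := by
    conv_rhs => rw [← hXh]
    ext x y
    simp only [conjTranspose_apply, localOp]
    by_cases h : ∀ q, q ∉ Set.range e → x q = y q
    · rw [if_pos h, if_pos fun q hq => (h q hq).symm]
    · rw [if_neg h, if_neg fun h' => h fun q hq => (h' q hq).symm, star_zero]
  rw [← conjTranspose_mul_self_eq_zero, conjTranspose_mul, hYh, Matrix.mul_assoc,
    ← Matrix.mul_assoc (localOp e X), ← localOp_mul, hXX, ← Matrix.mul_assoc, hc]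

end Loewner

section Totals

open Matrix Kronecker Filter Topology
open scoped MatrixOrder

/-! ### Sums of local operators -/

variable {T ι : Type*} [Fintype ι] [DecidableEq ι] {a : T → ℕ} {α β : Type*}
  [Fintype α] [DecidableEq α] [Fintype β] [DecidableEq β]

/-- The sum of the operators `A i`, applied at the places `e`, over a list of pairs `⟨i, e⟩`. -/
noncomputable def totalAt (A : ∀ i, Matrix (Fin (a i) → α) (Fin (a i) → α) ℂ)
    (l : List (Σ i, Fin (a i) ↪ ι)) : Matrix (ι → α) (ι → α) ℂ :=
  (l.map fun c => localOp c.2 (A c.1)).sum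

theorem totalAt_mono {A B : ∀ i, Matrix (Fin (a i) → α) (Fin (a i) → α) ℂ} (h : ∀ i, A i ≤ B i)
    (l : List (Σ i, Fin (a i) ↪ ι)) : totalAt A l ≤ totalAt B l :=
  List.sum_le_sum fun c _ => localOp_mono c.2 (h c.1)

theorem totalAt_smul (A : ∀ i, Matrix (Fin (a i) → α) (Fin (a i) → α) ℂ) (c : ℂ)
    (l : List (Σ i, Fin (a i) ↪ ι)) : totalAt (fun i => c • A i) l = c • totalAt A l := by
  simp only [totalAt, localOp_smul, List.smul_sum, List.map_map]
  rfl

theorem totalAt_compress {A : ∀ i, Matrix (Fin (a i) → α) (Fin (a i) → α) ℂ} {V : Matrix α β ℂ}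
    (hV : Vᴴ * V = 1) (l : List (Σ i, Fin (a i) ↪ ι)) :
    (tensorPow ι V)ᴴ * totalAt A l * tensorPow ι V =
      totalAt (fun i => (tensorPow (Fin (a i)) V)ᴴ * A i * tensorPow (Fin (a i)) V) l := by
  induction l with
  | nil => simp [totalAt]
  | cons c l ih =>
    simp only [totalAt, List.map_cons, List.sum_cons] at ih ⊢
    rw [Matrix.mul_add, Matrix.add_mul, ih, tensorPow_compress hV]

theorem totalAt_fstOp {A : ∀ i, Matrix (Fin (a i) → α) (Fin (a i) → α) ℂ} (γ : Type*) [Fintype γ]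
    [DecidableEq γ] (l : List (Σ i, Fin (a i) ↪ ι)) :
    totalAt (fun i => fstOp γ (A i)) l = fstOp γ (totalAt A l) := by
  induction l with
  | nil => simp [totalAt, fstOp_zero]
  | cons c l ih =>
    simp only [totalAt, List.map_cons, List.sum_cons] at ih ⊢
    rw [fstOp_add, ih, fstOp_localOp]

theorem compress_smul_one {m n : Type*} [Fintype m] [Fintype n] [DecidableEq m] [DecidableEq n]
    {A : Matrix m n ℂ} (hA : Aᴴ * A = 1) (c : ℂ) : 
    Aᴴ * (c • (1 : Matrix m m ℂ)) * A = c • (1 : Matrix n n ℂ) := by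
  rw [Matrix.mul_smul, Matrix.smul_mul, Matrix.mul_one, hA]

/-- Restrict to code states, where each encoded projector compresses to `P i`. -/
theorem le_totalAt_of_le_encProj {P : ∀ i, Matrix (Fin (a i) → β) (Fin (a i) → β) ℂ}
    {V : Matrix α β ℂ} (hV : Vᴴ * V = 1) {l : List (Σ i, Fin (a i) ↪ ι)} {ε : ℂ}
    (h : ε • 1 ≤ totalAt (fun i => encProj V (P i)) l) : ε • 1 ≤ totalAt P l := by
  have := compress_le h (tensorPow ι V)
  rw [totalAt_compress hV, compress_smul_one (tensorPow_isometry hV)] at this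
  simpa only [encProj_compress hV] using this

/-- States outside the code space are covered too: the bound survives adding the record register,
then compression by the product decoder, and each decoded clause is dominated by the encoded one.
Since the decoder acts on each factor separately, one decoder serves all clauses. -/
theorem le_totalAt_encProj {P : ∀ i, Matrix (Fin (a i) → β) (Fin (a i) → β) ℂ}
    (hP : ∀ i, IsStarProjection (P i)) {V : Matrix α β ℂ} (hV : Vᴴ * V = 1) (b₀ : β)
    {l : List (Σ i, Fin (a i) ↪ ι)} {ε : ℂ} (h : ε • 1 ≤ totalAt P l) :
    ε • 1 ≤ totalAt (fun i => encProj V (P i)) l := by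
  have hJ := decoder_isometry hV b₀
  have h1 := fstOp_mono (γ := Option α) h
  rw [fstOp_smul_one, ← totalAt_fstOp] at h1
  have h2 := compress_le h1 (tensorPow ι (decoder V b₀))
  rw [compress_smul_one (tensorPow_isometry hJ), totalAt_compress hJ] at h2
  exact h2.trans (totalAt_mono (fun i => compress_fstOp_le_encProj hV b₀ (hP i)) l)

end Totals

namespace QCSP

open Matrix Filter Topology
open scoped MatrixOrder

variable {d : ℕ}

/-! ### The total violation as an operator -/

/-- The sum of the clauses of an instance. -/
noncomputable def Instance.total {C : QCSP d} (I : C.Instance) : QuditOp d I.n :=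
  (I.clauses.map Clause.toOp).sum

theorem Clause.toOp_posSemidef {C : QCSP d} {n : ℕ} (c : C.Clause n) : c.toOp.PosSemidef := by
  rw [Clause.toOp, applyAt_eq_localOp]
  exact localOp_posSemidef _ (C.posSemidef _)

theorem Instance.total_posSemidef {C : QCSP d} (I : C.Instance) : I.total.PosSemidef := by
  rw [← Matrix.nonneg_iff_posSemidef]
  refine List.sum_nonneg fun A hA => ?_
  obtain ⟨c, _, rfl⟩ := List.mem_map.1 hA
  exact Matrix.nonneg_iff_posSemidef.2 c.toOp_posSemidef

theorem Instance.violation_eq {C : QCSP d} (I : C.Instance) (ψ : QuditVec d I.n) :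
    I.violation ψ = (star ψ ⬝ᵥ (I.total *ᵥ ψ)).re := by
  unfold violation total
  induction I.clauses with
  | nil => simp
  | cons c l ih =>
    simp only [List.map_cons, List.sum_cons, Matrix.add_mulVec, dotProduct_add, Complex.add_re]
    rw [ih]

/-- In this form the bound can be compressed by isometries and compared clause by clause. The proof
rescales an arbitrary nonzero vector to a unit vector. -/
theorem Instance.violatedBy_iff {C : QCSP d} (I : C.Instance) (ε : ℝ) :
    I.ViolatedBy ε ↔ (ε : ℂ) • 1 ≤ I.total := by
  have hH : (I.total - (ε : ℂ) • 1).IsHermitian :=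
    I.total_posSemidef.isHermitian.sub (by simp [IsHermitian])
  have hq : ∀ ψ : QuditVec d I.n, star ψ ⬝ᵥ ((I.total - (ε : ℂ) • 1) *ᵥ ψ) =
      star ψ ⬝ᵥ (I.total *ᵥ ψ) - ε * (star ψ ⬝ᵥ ψ) := by
    intro ψ
    rw [Matrix.sub_mulVec, dotProduct_sub, Matrix.smul_mulVec, Matrix.one_mulVec, dotProduct_smul,
      smul_eq_mul]
  have hre : ∀ ψ : QuditVec d I.n, star ψ ⬝ᵥ (I.total *ᵥ ψ) = (I.violation ψ : ℂ) := by
    intro ψ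
    rw [I.violation_eq]
    exact (Complex.conj_eq_iff_re.1 (Complex.conj_eq_iff_im.2
      (Complex.nonneg_iff.1 (I.total_posSemidef.dotProduct_mulVec_nonneg ψ)).2.symm)).symm
  rw [Matrix.le_iff, posSemidef_iff_dotProduct_mulVec]
  constructor
  · intro h
    refine ⟨hH, fun ψ => ?_⟩
    by_cases h0 : ψ = 0
    · simp [h0]
    set r := (star ψ ⬝ᵥ ψ).re with hr
    have hrψ : star ψ ⬝ᵥ ψ = (r : ℂ) := by
      exact (Complex.conj_eq_iff_re.1 (Complex.conj_eq_iff_im.2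
        (Complex.nonneg_iff.1 (dotProduct_star_self_nonneg ψ)).2.symm)).symm
    have hpos : 0 < r := by
      have h1 : 0 < star ψ ⬝ᵥ ψ := dotProduct_star_self_pos_iff.2 h0
      rw [hrψ] at h1
      exact_mod_cast h1
    have hs : ((Real.sqrt r)⁻¹ * (Real.sqrt r)⁻¹ : ℝ) = r⁻¹ := by
      rw [← mul_inv, Real.mul_self_sqrt hpos.le]
    have hu := h (((Real.sqrt r)⁻¹ : ℝ) • ψ) (by
      rw [star_smul, smul_dotProduct, dotProduct_smul, hrψ, smul_smul, star_trivial, hs,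
        Complex.real_smul, ← Complex.ofReal_mul, inv_mul_cancel₀ hpos.ne', Complex.ofReal_one])
    rw [I.violation_eq, star_smul, Matrix.mulVec_smul, smul_dotProduct, dotProduct_smul,
      smul_smul, star_trivial, hs, Complex.smul_re, ← I.violation_eq, smul_eq_mul] at hu
    rw [hq, hre, hrψ]
    have : ε * r ≤ I.violation ψ := by
      rwa [inv_mul_eq_div, le_div_iff₀ hpos] at hu
    rw [← Complex.ofReal_mul, ← Complex.ofReal_sub]
    exact_mod_cast sub_nonneg.2 this
  · rintro ⟨_, h⟩ ψ hψ
    have := h ψ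
    rw [hq, hre, hψ, mul_one, ← Complex.ofReal_sub] at this
    exact sub_nonneg.1 (by exact_mod_cast this)

/-- The terms of the violation are nonnegative, and a positive semidefinite form vanishes only on
the kernel. -/
theorem Instance.satisfiable_iff {C : QCSP d} (I : C.Instance) :
    I.Satisfiable ↔ ∃ ψ : QuditVec d I.n, star ψ ⬝ᵥ ψ = 1 ∧ I.violation ψ = 0 := by
  refine exists_congr fun ψ => and_congr_right fun _ => ?_
  have hre : ∀ c : C.Clause I.n, (star ψ ⬝ᵥ (c.toOp *ᵥ ψ)).re = 0 ↔ c.toOp *ᵥ ψ = 0 := by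
    intro c
    rw [← c.toOp_posSemidef.dotProduct_mulVec_zero_iff]
    have := (Complex.nonneg_iff.1 (c.toOp_posSemidef.dotProduct_mulVec_nonneg ψ)).2
    exact ⟨fun h => Complex.ext h this.symm, fun h => by rw [h]; rfl⟩
  have hnn : ∀ c : C.Clause I.n, 0 ≤ (star ψ ⬝ᵥ (c.toOp *ᵥ ψ)).re := fun c =>
    (Complex.nonneg_iff.1 (c.toOp_posSemidef.dotProduct_mulVec_nonneg ψ)).1
  unfold violation
  constructor
  · intro h
    refine List.sum_eq_zero fun x hx => ?_
    obtain ⟨c, hc, rfl⟩ := List.mem_map.1 hx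
    exact (hre c).2 (h c hc)
  · intro h c hc
    rw [← hre]
    refine le_antisymm ?_ (hnn c)
    rw [← h]
    refine List.single_le_sum (fun x hx => ?_) _ (List.mem_map_of_mem hc)
    obtain ⟨c', _, rfl⟩ := List.mem_map.1 hx
    exact hnn c'

theorem Instance.not_violatedBy {C : QCSP d} {I : C.Instance} (hI : I.Satisfiable) {ε : ℝ}
    (hε : 0 < ε) : ¬ I.ViolatedBy ε := by
  obtain ⟨ψ, h1, h2⟩ := I.satisfiable_iff.1 hI
  exact fun h => absurd (h ψ h1) (by rw [h2]; exact not_le.2 hε)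

/-- By compactness, the violation of an unsatisfiable instance is bounded below. -/
theorem Instance.exists_violatedBy {C : QCSP d} {I : C.Instance} (hI : ¬ I.Satisfiable) :
    ∃ ε : ℝ, 0 < ε ∧ ε ≤ 1 ∧ I.ViolatedBy ε := by
  set S : Set (QuditVec d I.n) := {ψ | star ψ ⬝ᵥ ψ = 1} with hS
  have hcont : Continuous fun ψ : QuditVec d I.n => I.violation ψ := by
    simp only [I.violation_eq, dotProduct, mulVec]
    fun_prop
  have hcomp : IsCompact S := by
    refine Metric.isCompact_of_isClosed_isBounded ?_ ?_
    · refine isClosed_eq ?_ continuous_const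
      simp only [dotProduct]
      fun_prop
    · refine (Metric.isBounded_closedBall (x := (0 : QuditVec d I.n)) (r := 1)).subset ?_
      intro ψ hψ
      rw [mem_closedBall_zero_iff, pi_norm_le_iff_of_nonneg zero_le_one]
      intro x
      have h1 : ∑ y, ‖ψ y‖ ^ 2 = 1 := by
        have h2 : star ψ ⬝ᵥ ψ = ((∑ y, ‖ψ y‖ ^ 2 : ℝ) : ℂ) := by
          simp [dotProduct, Complex.conj_mul']
        rw [hS, Set.mem_ofPred_eq, h2] at hψ
        exact_mod_cast hψ
      have h3 : ‖ψ x‖ ^ 2 ≤ 1 := by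
        rw [← h1]
        exact Finset.single_le_sum (f := fun y => ‖ψ y‖ ^ 2) (fun y _ => by positivity)
          (Finset.mem_univ x)
      nlinarith [norm_nonneg (ψ x)]
  -- Without unit vectors, as for `d = 0` and a positive number of qudits, the bound is vacuous;
  -- otherwise the minimum on the unit sphere is attained.
  rcases S.eq_empty_or_nonempty with hemp | hne
  · refine ⟨1, one_pos, le_rfl, fun ψ hψ => ?_⟩
    have : ψ ∈ S := hψ
    simp [hemp] at this
  · obtain ⟨ψ, hψ, hmin⟩ := hcomp.exists_isMinOn hne hcont.continuousOn
    have h0 : 0 ≤ I.violation ψ := by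
      rw [I.violation_eq]
      exact (Complex.nonneg_iff.1 (I.total_posSemidef.dotProduct_mulVec_nonneg ψ)).1
    have hpos : 0 < I.violation ψ :=
      lt_of_le_of_ne h0 fun h => hI (I.satisfiable_iff.2 ⟨ψ, hψ, h.symm⟩)
    exact ⟨min (I.violation ψ) 1, lt_min hpos one_pos, min_le_right _ _,
      fun φ hφ => (min_le_left _ _).trans (hmin hφ)⟩

end QCSP

/-! ### Encoding qudits in blocks of qubits -/

section Blocks

open Matrix Filter Topology
open scoped MatrixOrder

/-- The word made of `a` blocks of `N` letters, as a word of blocks. -/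
def blockWord (a N : ℕ) (α : Type*) : (Fin (a * N) → α) ≃ (Fin a → Fin N → α) :=
  (Equiv.arrowCongr finProdFinEquiv.symm (Equiv.refl α)).trans (Equiv.curry (Fin a) (Fin N) α)

/-- The places of the blocks of `N` letters at `e`. -/
def blockEmb {Λ Q : Type*} {a N : ℕ} (e : Fin a ↪ Λ) (B : Λ × Fin N ↪ Q) : Fin (a * N) ↪ Q :=
  (finProdFinEquiv.symm.toEmbedding.trans (e.prodMap (Function.Embedding.refl _))).trans B

theorem blockEmb_apply {Λ Q : Type*} {a N : ℕ} (e : Fin a ↪ Λ) (B : Λ × Fin N ↪ Q) (b : Fin a)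
    (t : Fin N) : blockEmb e B (finProdFinEquiv (b, t)) = B (e b, t) := by
  simp [blockEmb]

/-- Regrouping the qubits into blocks turns a clause on qubits into one on letters of the alphabet
`Fin N → α`, where the tensor power lemmas apply. -/
theorem localOp_blockEmb {Λ Q α : Type*} {a N : ℕ} (e : Fin a ↪ Λ) (B : Λ × Fin N ↪ Q)
    (M : Matrix (Fin a → Fin N → α) (Fin a → Fin N → α) ℂ) :
    localOp (blockEmb e B) (M.submatrix (blockWord a N α) (blockWord a N α)) =
      localOp B ((localOp e M).submatrix (Equiv.curry Λ (Fin N) α) (Equiv.curry Λ (Fin N) α)) := by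
  classical
  rw [blockEmb, ← localOp_localOp]
  congr 1
  ext x y
  simp only [localOp, submatrix_apply]
  have hw : ∀ x : Λ × Fin N → α, blockWord a N α
      (x ∘ (finProdFinEquiv.symm.toEmbedding.trans (e.prodMap (Function.Embedding.refl _)))) =
      Equiv.curry Λ (Fin N) α x ∘ e := by
    intro x
    funext b t
    simp [blockWord, Equiv.arrowCongr]
  rw [hw, hw]
  refine if_congr ⟨fun h l hl => funext fun t => h (l, t) ?_, fun h p hp => ?_⟩ rfl rfl
  · rintro ⟨s, hs⟩
    exact hl ⟨(finProdFinEquiv.symm s).1, congrArg Prod.fst hs⟩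
  · refine congrFun (h p.1 ?_) p.2
    rintro ⟨b, hb⟩
    exact hp ⟨finProdFinEquiv (b, p.2), by simp [hb]⟩

end Blocks

section

open Matrix Filter Topology
open scoped MatrixOrder

theorem IsStarProjection.submatrix_equiv {m n : Type*} [Fintype m] [Fintype n] {P : Matrix n n ℂ}
    (hP : IsStarProjection P) (e : m ≃ n) : IsStarProjection (P.submatrix e e) := by
  refine ⟨?_, ?_⟩
  · show _ * _ = _
    rw [submatrix_mul_equiv, hP.isIdempotentElem.eq]
  · show (P.submatrix _ _)ᴴ = _
    rw [conjTranspose_submatrix]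
    exact congrArg (fun M : Matrix n n ℂ => M.submatrix e e) hP.isSelfAdjoint

/-- Factors on which nothing acts do not affect a lower bound, so unused qudits and qubits can be
ignored. -/
theorem smul_one_le_localOp_iff {κ ι α : Type*} [Fintype κ] [DecidableEq κ] [Fintype ι]
    [DecidableEq ι] [Fintype α] [DecidableEq α] [Nonempty α] (e : κ ↪ ι)
    (A : Matrix (κ → α) (κ → α) ℂ) (c : ℂ) : c • 1 ≤ localOp e A ↔ c • 1 ≤ A := by
  have h1 : (c • 1 : Matrix (ι → α) (ι → α) ℂ) = localOp e (c • 1) := by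
    rw [localOp_smul, localOp_one]
  rw [h1]
  refine ⟨fun h => ?_, localOp_mono e⟩
  rw [Matrix.le_iff, ← localOp_sub] at h
  exact posSemidef_of_localOp e h

theorem smul_one_le_submatrix_iff {m n : Type*} [Fintype m] [DecidableEq m] [Fintype n]
    [DecidableEq n] (e : m ≃ n) (A : Matrix n n ℂ) (c : ℂ) :
    c • 1 ≤ A.submatrix e e ↔ c • 1 ≤ A := by
  have h1 : (c • 1 : Matrix m m ℂ) = (c • 1 : Matrix n n ℂ).submatrix e e := by
    rw [submatrix_smul]
    simp
  rw [Matrix.le_iff, Matrix.le_iff, h1]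
  exact posSemidef_submatrix_equiv (M := A - c • 1) e

end

/-! ### The encoded problem and its instances -/

namespace QCSP

open Matrix Filter Topology
open scoped MatrixOrder

variable {d : ℕ}

/-- The qubit version of a constraint satisfaction problem on qudits: every qudit is encoded in a
block of `N` qubits by the isometry `V`, and clause type `i` enforces both the code space of its
blocks and the kernel of the projector `P i`. -/
noncomputable def encoded (C : QCSP d) {N : ℕ} {V : Matrix (Fin N → Fin 2) (Fin d) ℂ}
    (hV : Vᴴ * V = 1) {P : ∀ i, QuditOp d (C.arity i)} (hP : ∀ i, IsStarProjection (P i)) :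
    QCSP 2 where
  numTypes := C.numTypes
  arity i := C.arity i * N
  op i := (encProj V (P i)).submatrix (blockWord (C.arity i) N (Fin 2))
    (blockWord (C.arity i) N (Fin 2))
  posSemidef i := (encProj_isStarProjection hV (hP i)).posSemidef.submatrix _

section Encoded

variable {C : QCSP d} {N : ℕ} {V : Matrix (Fin N → Fin 2) (Fin d) ℂ} (hV : Vᴴ * V = 1)
  {P : ∀ i, QuditOp d (C.arity i)} (hP : ∀ i, IsStarProjection (P i))

theorem encoded_isProjective : (C.encoded hV hP).IsProjective :=
  fun i => (encProj_isStarProjection hV (hP i)).submatrix_equiv _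

/-- The clause of the encoded problem on the blocks of the qudits of a clause. -/
def blockClause {Λ : Type*} {n' : ℕ} (B : Λ × Fin N ↪ Fin n')
    (c : Σ i, Fin (C.arity i) ↪ Λ) : (C.encoded hV hP).Clause n' :=
  ⟨c.1, blockEmb c.2 B⟩

/-- The clause on the qudits that the elements of `Λ` stand for. -/
def placedClause {C : QCSP d} {Λ : Type*} {n : ℕ} (l : Λ ↪ Fin n)
    (c : Σ i, Fin (C.arity i) ↪ Λ) : C.Clause n :=
  ⟨c.1, c.2.trans l⟩

theorem placedClause_toOp {C : QCSP d} {Λ : Type*} {n : ℕ} (l : Λ ↪ Fin n)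
    (c : Σ i, Fin (C.arity i) ↪ Λ) :
    (placedClause l c).toOp = localOp (c.2.trans l) (C.op c.1) := by
  rw [Clause.toOp, applyAt_eq_localOp]
  rfl

theorem blockClause_toOp {Λ : Type*} {n' : ℕ} (B : Λ × Fin N ↪ Fin n')
    (c : Σ i, Fin (C.arity i) ↪ Λ) :
    (blockClause hV hP B c).toOp = localOp B ((localOp c.2 (encProj V (P c.1))).submatrix
      (Equiv.curry Λ (Fin N) (Fin 2)) (Equiv.curry Λ (Fin N) (Fin 2))) := by
  rw [Clause.toOp, applyAt_eq_localOp]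
  exact localOp_blockEmb c.2 B _

variable {Λ : Type*} [Fintype Λ] [DecidableEq Λ] {n n' : ℕ} (l : Λ ↪ Fin n)
  (B : Λ × Fin N ↪ Fin n') (L : List (Σ i, Fin (C.arity i) ↪ Λ))

/-- One list `L` on an abstract set `Λ` of sites underlies both instances: `l` realises the sites as
qudits and `B` as disjoint blocks of qubits. Both bounds thus reduce to inequalities on `Λ`. -/
theorem violatedBy_placed_iff (hd : 0 < d) (ε : ℝ) :
    (⟨n, L.map (placedClause l)⟩ : C.Instance).ViolatedBy ε ↔ (ε : ℂ) • 1 ≤ totalAt C.op L := by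
  have : Nonempty (Fin d) := ⟨⟨0, hd⟩⟩
  rw [Instance.violatedBy_iff, ← smul_one_le_localOp_iff l]
  have : Instance.total (⟨n, L.map (placedClause l)⟩ : C.Instance) =
      localOp l (totalAt C.op L) := by
    unfold Instance.total totalAt
    dsimp only
    induction L with
    | nil => simp [localOp_zero]
    | cons c L ih =>
      simp only [List.map_cons, List.sum_cons]
      rw [ih, localOp_add, localOp_localOp, placedClause_toOp]
  rw [this]

theorem violatedBy_block_iff (ε : ℝ) :
    (⟨n', L.map (blockClause hV hP B)⟩ : (C.encoded hV hP).Instance).ViolatedBy ε ↔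
      (ε : ℂ) • 1 ≤ totalAt (fun i => encProj V (P i)) L := by
  rw [Instance.violatedBy_iff, ← smul_one_le_submatrix_iff (Equiv.curry Λ (Fin N) (Fin 2)),
    ← smul_one_le_localOp_iff B]
  have : Instance.total
      (⟨n', L.map (blockClause hV hP B)⟩ : (C.encoded hV hP).Instance) =
      localOp B ((totalAt (fun i => encProj V (P i)) L).submatrix
        (Equiv.curry Λ (Fin N) (Fin 2)) (Equiv.curry Λ (Fin N) (Fin 2))) := by
    unfold Instance.total totalAt
    dsimp only
    induction L with
    | nil => simp [localOp_zero]
    | cons c L ih =>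
      simp only [List.map_cons, List.sum_cons]
      rw [ih, blockClause_toOp, submatrix_add, Pi.add_apply, Pi.add_apply, localOp_add]
  rw [this]

variable {δ : ℝ} (hδ : 0 < δ)
  (hPδ : ∀ i, (δ : ℂ) • C.op i ≤ P i ∧ (δ : ℂ) • P i ≤ C.op i)

include hδ hPδ

theorem violatedBy_block_of_placed (hd : 0 < d) {ε : ℝ}
    (h : (⟨n, L.map (placedClause l)⟩ : C.Instance).ViolatedBy ε) :
    (⟨n', L.map (blockClause hV hP B)⟩ : (C.encoded hV hP).Instance).ViolatedBy (δ * ε) := by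
  rw [violatedBy_placed_iff l L hd] at h
  rw [violatedBy_block_iff]
  refine le_totalAt_encProj hP hV ⟨0, hd⟩ ?_
  refine le_trans ?_ (totalAt_mono (fun i => (hPδ i).1) L)
  rw [totalAt_smul, Complex.ofReal_mul, mul_smul]
  exact smul_le_smul_of_nonneg_left h (by exact_mod_cast hδ.le)

theorem violatedBy_placed_of_block (hd : 0 < d) {ε : ℝ}
    (h : (⟨n', L.map (blockClause hV hP B)⟩ : (C.encoded hV hP).Instance).ViolatedBy ε) :
    (⟨n, L.map (placedClause l)⟩ : C.Instance).ViolatedBy (δ * ε) := by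
  rw [violatedBy_block_iff] at h
  rw [violatedBy_placed_iff l L hd]
  refine le_trans ?_ (totalAt_mono (fun i => (hPδ i).2) L)
  rw [totalAt_smul, Complex.ofReal_mul, mul_smul]
  exact smul_le_smul_of_nonneg_left (le_totalAt_of_le_encProj hV h) (by exact_mod_cast hδ.le)

/-- An unsatisfiable instance has a positive lower bound on its violation. The bound carries over in
either direction, so the other instance is unsatisfiable as well. -/
theorem satisfiable_block_iff (hd : 0 < d) :
    (⟨n', L.map (blockClause hV hP B)⟩ : (C.encoded hV hP).Instance).Satisfiable ↔
      (⟨n, L.map (placedClause l)⟩ : C.Instance).Satisfiable := by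
  constructor
  · intro h
    by_contra hn
    obtain ⟨ε, hε, _, hv⟩ := Instance.exists_violatedBy hn
    exact Instance.not_violatedBy h (mul_pos hδ hε)
      (violatedBy_block_of_placed hV hP l B L hδ hPδ hd hv)
  · intro h
    by_contra hn
    obtain ⟨ε, hε, _, hv⟩ := Instance.exists_violatedBy hn
    exact Instance.not_violatedBy h (mul_pos hδ hε)
      (violatedBy_placed_of_block hV hP l B L hδ hPδ hd hv)

end Encoded

/-- Projectors onto the ranges of the clause types, and a constant by which they are comparable. -/
theorem exists_rangeProjs (C : QCSP d) : ∃ P : ∀ i, QuditOp d (C.arity i),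
    (∀ i, IsStarProjection (P i)) ∧
      ∃ δ : ℝ, 0 < δ ∧ ∀ i, (δ : ℂ) • C.op i ≤ P i ∧ (δ : ℂ) • P i ≤ C.op i := by
  choose P hP hc using fun i => exists_rangeProj (C.posSemidef i)
  refine ⟨P, hP, ?_⟩
  -- There are finitely many clause types, so one small constant serves them all.
  obtain ⟨δ, h1, h2⟩ := ((eventually_all.2 hc).and self_mem_nhdsWithin).exists
  exact ⟨δ, h2, h1⟩

/-- The places of block `b` in a word of `a` blocks of `N` letters. -/
def blockPlaces {a : ℕ} (N : ℕ) (b : Fin a) : Fin N ↪ Fin (a * N) :=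
  ⟨fun t => finProdFinEquiv (b, t), fun s t hst => by simpa using hst⟩

/-- The code space test of one block annihilates the tensor power of `V`, and with it the correction
term in `encProj`. Hence the kernel of `encProj` lies in the kernel of this test. -/
theorem localOp_blockPlaces_mul_encProj {d a N : ℕ} {V : Matrix (Fin N → Fin 2) (Fin d) ℂ}
    (hV : Vᴴ * V = 1) (P : QuditOp d a) (b : Fin a) :
    localOp (blockPlaces N b) (1 - V * Vᴴ) *
      (encProj V P).submatrix (blockWord a N (Fin 2)) (blockWord a N (Fin 2)) =
    localOp (blockPlaces N b) (1 - V * Vᴴ) := by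
  set u : Unit ↪ Fin a := ⟨fun _ => b, fun _ _ _ => rfl⟩ with hu
  set X : Matrix (Unit → Fin N → Fin 2) (Unit → Fin N → Fin 2) ℂ :=
    1 - tensorPow Unit V * (tensorPow Unit V)ᴴ with hX
  have h1 : localOp u X * encProj V P = localOp u X := by
    rw [encProj, Matrix.mul_sub, Matrix.mul_one, ← Matrix.mul_assoc, ← Matrix.mul_assoc,
      localOp_compl_mul_tensorPow hV]
    simp
  set w := blockWord a N (Fin 2) with hw
  have h3 : localOp (blockPlaces N b) (1 - V * Vᴴ) = (localOp u X).submatrix w w := by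
    classical
    ext x y
    simp only [localOp, submatrix_apply]
    have hwx : ∀ (x : Fin (a * N) → Fin 2) b t, w x b t = x (finProdFinEquiv (b, t)) := by
      intro x b t
      simp [hw, blockWord, Equiv.arrowCongr]
    have hXe : X (w x ∘ u) (w y ∘ u) =
        (1 - V * Vᴴ : Matrix _ _ ℂ) (x ∘ blockPlaces N b) (y ∘ blockPlaces N b) := by
      simp only [hX, Matrix.sub_apply, Matrix.mul_apply, conjTranspose_apply, tensorPow,
        Finset.univ_unique, Finset.prod_singleton, PUnit.default_eq_unit, Matrix.one_apply]
      congr 1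
      · refine if_congr ⟨fun h => ?_, fun h => ?_⟩ rfl rfl
        · exact congrFun h ()
        · exact funext fun _ => h
      · exact Fintype.sum_equiv (Equiv.funUnique Unit (Fin d)) _ _ fun _ => rfl
    have key : (∀ s, s ∉ Set.range (blockPlaces N b) → x s = y s) ↔
        ∀ b', b' ∉ Set.range u → w x b' = w y b' := by
      refine ⟨fun h b' hb' => funext fun t => ?_, fun h s hs => ?_⟩
      · rw [hwx, hwx]
        refine h _ ?_
        rintro ⟨s, hs⟩
        have : b = b' := congrArg Prod.fst (finProdFinEquiv.injective hs)
        exact hb' ⟨(), this⟩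
      · have hb : (finProdFinEquiv.symm s).1 ∉ Set.range u := by
          rintro ⟨_, hb⟩
          refine hs ⟨(finProdFinEquiv.symm s).2, ?_⟩
          show finProdFinEquiv (b, _) = s
          rw [show b = (finProdFinEquiv.symm s).1 from hb, Prod.mk.eta, Equiv.apply_symm_apply]
        have := congrFun (h _ hb) (finProdFinEquiv.symm s).2
        rwa [hwx, hwx, Prod.mk.eta, Equiv.apply_symm_apply] at this
    rw [hXe]
    by_cases h : ∀ s, s ∉ Set.range (blockPlaces N b) → x s = y s
    · rw [if_pos h, if_pos (key.1 h)]
    · rw [if_neg h, if_neg (mt key.2 h)]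
  rw [h3, submatrix_mul_equiv, h1]

theorem localOp_blockPlaces_mulVec_eq_zero {d a N n : ℕ} {V : Matrix (Fin N → Fin 2) (Fin d) ℂ}
    (hV : Vᴴ * V = 1) (P : QuditOp d a) (b : Fin a) (q : Fin (a * N) ↪ Fin n) {ψ : QuditVec 2 n}
    (h : localOp q ((encProj V P).submatrix (blockWord a N (Fin 2)) (blockWord a N (Fin 2))) *ᵥ ψ
      = 0) :
    localOp ((blockPlaces N b).trans q) (1 - V * Vᴴ) *ᵥ ψ = 0 := by
  rw [← localOp_localOp, ← localOp_blockPlaces_mul_encProj hV P b, localOp_mul,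
    ← Matrix.mulVec_mulVec, h, Matrix.mulVec_zero]

/-- Every block of a satisfied clause of the encoded problem is in the code space. -/
theorem block_mulVec_eq_zero {C : QCSP d} {N : ℕ} {V : Matrix (Fin N → Fin 2) (Fin d) ℂ}
    (hV : Vᴴ * V = 1) {P : ∀ i, QuditOp d (C.arity i)} (hP : ∀ i, IsStarProjection (P i)) {n : ℕ}
    (c : (C.encoded hV hP).Clause n) {ψ : QuditVec 2 n} (h : c.toOp *ᵥ ψ = 0)
    (b : Fin (C.arity c.type)) :
    applyAt ((blockPlaces N b).trans c.qudits) (1 - V * Vᴴ) *ᵥ ψ = 0 := by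
  rw [Clause.toOp, applyAt_eq_localOp] at h
  rw [applyAt_eq_localOp]
  exact localOp_blockPlaces_mulVec_eq_zero hV (P c.type) b c.qudits h

end QCSP

section Rigid

open Matrix

/-! ### Codes whose blocks cannot overlap -/

/-- A multiple of the projector onto the orthogonal complement of the range of `W`, with entries
polynomial in those of `W`. -/
noncomputable def complOp {m n R : Type*} [Fintype m] [DecidableEq m] [Fintype n] [DecidableEq n]
    [CommRing R] (W : Matrix m n R) : Matrix m m R :=
  (Wᵀ * W).det • (1 : Matrix m m R) - W * (Wᵀ * W).adjugate * Wᵀ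

section ComplOp

variable {m n R S : Type*} [Fintype m] [DecidableEq m] [Fintype n] [DecidableEq n]
    [CommRing R] [CommRing S]

/-- Being polynomial, `complOp` commutes with ring homomorphisms: evaluation of indeterminates, and
the passage from ℝ to ℂ. -/
theorem complOp_map (f : R →+* S) (W : Matrix m n R) :
    complOp (W.map f) = (complOp W).map f := by
  have h1 : (W.map f)ᵀ * W.map f = (Wᵀ * W).map f := by
    rw [Matrix.map_mul, transpose_map]
  rw [complOp, complOp, Matrix.map_sub f (map_sub f), Matrix.map_mul, Matrix.map_mul,
    transpose_map, h1, ← RingHom.mapMatrix_apply f (Wᵀ * W), ← RingHom.map_adjugate, ← RingHom.map_det,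
    RingHom.mapMatrix_apply]
  congr 1
  ext i j
  simp [Matrix.one_apply, apply_ite f]

theorem complOp_mul_self (W : Matrix m n R) : complOp W * W = 0 := by
  rw [complOp, Matrix.sub_mul, Matrix.mul_assoc, Matrix.mul_assoc, adjugate_mul]
  simp

end ComplOp

theorem exists_eq_mulVec_of_complOp {m n : Type*} [Fintype m] [DecidableEq m] [Fintype n]
    [DecidableEq n] {W : Matrix m n ℝ} (hW : (Wᵀ * W).det ≠ 0) {u : m → ℝ}
    (hu : complOp W *ᵥ u = 0) : ∃ a, u = W *ᵥ a := by
  rw [complOp, Matrix.sub_mulVec, sub_eq_zero, Matrix.smul_mulVec, Matrix.one_mulVec] at hu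
  refine ⟨(Wᵀ * W).det⁻¹ • (((Wᵀ * W).adjugate * Wᵀ) *ᵥ u), ?_⟩
  rw [Matrix.mulVec_smul, Matrix.mulVec_mulVec, ← Matrix.mul_assoc, ← hu, smul_smul,
    inv_mul_cancel₀ hW, one_smul]

/-- The rows `s x` of `W` form an identity matrix, so `W` is injective and its real Gram matrix is
nonsingular. -/
theorem det_transpose_mul_self_ne_zero {m n : Type*} [Fintype m] [Fintype n]
    [DecidableEq n] {W : Matrix m n ℝ} (s : n → m)
    (hs : ∀ x y, W (s x) y = if x = y then 1 else 0) : (Wᵀ * W).det ≠ 0 := by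
  intro h
  obtain ⟨v, hv, h0⟩ := exists_mulVec_eq_zero_iff.2 h
  rw [← conjTranspose_eq_transpose_of_trivial, conjTranspose_mul_self_mulVec_eq_zero] at h0
  refine hv (funext fun x => ?_)
  simpa [mulVec, dotProduct, hs] using congrFun h0 (s x)

section Slices

variable {κ ι α n : Type*} [Fintype κ] [DecidableEq κ] [Fintype ι] [DecidableEq ι] [Fintype α]
  [DecidableEq α] [Fintype n] [DecidableEq n] {W : Matrix (κ → α) n ℝ}
  (hW : (Wᵀ * W).det ≠ 0) (e : κ ↪ ι) {ψ : (ι → α) → ℝ} (hψ : localOp e (complOp W) *ᵥ ψ = 0)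

theorem extend_comp_self (z : ι → α) : Function.extend e (z ∘ e) z = z := by
  funext q
  by_cases hq : ∃ k, e k = q
  · obtain ⟨k, rfl⟩ := hq
    rw [e.injective.extend_apply, Function.comp_apply]
  · rw [Function.extend_apply' _ _ _ hq]

include hW hψ

/-- Each slice of `ψ` along the block is a combination of columns of `W`, so it is supported where
these are. -/
theorem of_ne_zero_of_localOp_complOp {p : (κ → α) → Prop} (hp : ∀ u x, W u x ≠ 0 → p u)
    {z : ι → α} (hz : ψ z ≠ 0) : p (z ∘ e) := by
  obtain ⟨a, ha⟩ := exists_eq_mulVec_of_complOp hW ((localOp_mulVec_eq_zero_iff e _ ψ).1 hψ z)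
  have h1 := congrFun ha (z ∘ e)
  simp only [extend_comp_self] at h1
  rw [h1, mulVec, dotProduct] at hz
  obtain ⟨x, _, hx⟩ := Finset.exists_ne_zero_of_sum_ne_zero hz
  exact hp _ x (left_ne_zero_of_mul hx)

/-- Each slice of `ψ` along the block inherits a symmetry shared by all columns of `W`. -/
theorem eq_of_localOp_complOp {τ : (κ → α) → κ → α} (hτ : ∀ u x, W (τ u) x = W u x)
    (z : ι → α) : ψ (Function.extend e (τ (z ∘ e)) z) = ψ z := by
  obtain ⟨a, ha⟩ := exists_eq_mulVec_of_complOp hW ((localOp_mulVec_eq_zero_iff e _ ψ).1 hψ z)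
  have h1 := congrFun ha (z ∘ e)
  have h2 := congrFun ha (τ (z ∘ e))
  simp only [extend_comp_self] at h1
  rw [h1]
  exact h2.trans (by simp only [mulVec, dotProduct, hτ])

end Slices

/-- The `N - 2` positions other than `i` and `j` leave enough room for `d` different words. -/
theorem exists_words {N d : ℕ} (h : d ≤ 2 ^ (N - 2)) {i j : Fin N} (hij : i ≠ j) (b c : Fin 2) :
    ∃ s : Fin d ↪ (Fin N → Fin 2), ∀ x, s x i = b ∧ s x j = c := by
  have hcard : Fintype.card {q : Fin N // q ∉ ({i, j} : Finset (Fin N))} = N - 2 := by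
    rw [Fintype.card_subtype_compl, Fintype.card_fin, Fintype.card_coe, Finset.card_pair hij]
  obtain ⟨t⟩ : Nonempty (Fin d ↪ ({q : Fin N // q ∉ ({i, j} : Finset (Fin N))} → Fin 2)) := by
    refine Function.Embedding.nonempty_of_card_le ?_
    rw [Fintype.card_fun, hcard, Fintype.card_fin, Fintype.card_fin]
    exact h
  refine ⟨⟨fun x q => if h : q ∉ ({i, j} : Finset (Fin N)) then t x ⟨q, h⟩ else
    if q = i then b else c, fun x y hxy => t.injective (funext fun q => ?_)⟩, fun x => ?_⟩
  · have := congrFun hxy q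
    simpa only [dif_pos q.2] using this
  · simp [hij.symm]

/-- Flipping the bits `i` and `j` of a word. -/
def flipBits {N : ℕ} (i j : Fin N) (u : Fin N → Fin 2) : Fin N → Fin 2 :=
  fun q => if q = i ∨ q = j then u q + 1 else u q

theorem flipBits_flipBits {N : ℕ} (i j : Fin N) (u : Fin N → Fin 2) :
    flipBits i j (flipBits i j u) = u := by
  funext q
  simp only [flipBits]
  split_ifs
  · generalize u q = b
    revert b
    decide
  · rfl

/-- The overlaps of two different blocks of `N` qubits: the second block is `σ`, in a system whose
first `N` qubits are the first block. -/
def IsOverlap {N : ℕ} (σ : Fin N ↪ Fin N ⊕ Fin N) : Prop :=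
  σ ≠ Function.Embedding.inl ∧ ∃ i j, σ j = Sum.inl i

theorem exists_code_of_isOverlap {N d : ℕ} (h : d ≤ 2 ^ (N - 2)) {σ : Fin N ↪ Fin N ⊕ Fin N}
    (hσ : IsOverlap σ) : ∃ W : Matrix (Fin N → Fin 2) (Fin d) ℝ, (Wᵀ * W).det ≠ 0 ∧
      ∀ ψ : (Fin N ⊕ Fin N → Fin 2) → ℝ,
        localOp Function.Embedding.inl (complOp W) *ᵥ ψ = 0 → localOp σ (complOp W) *ᵥ ψ = 0 →
          ψ = 0 := by
  obtain ⟨hne, i₀, j₀, h₀⟩ := hσ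
  by_cases hcase : ∃ i j, σ j = Sum.inl i ∧ i ≠ j
  · obtain ⟨i, j, hσij, hij⟩ := hcase
    -- Misaligned overlap: the common qubit is number `i` of the first block and number `j` of the
    -- second. Code words with bit `i` equal to 0 and bit `j` equal to 1 make contradictory demands
    -- on it.
    obtain ⟨s, hs⟩ := exists_words h hij 0 1
    refine ⟨of fun u x => if u = s x then 1 else 0,
      det_transpose_mul_self_ne_zero s fun x y => by simp, fun ψ h1 h2 => ?_⟩
    have hdet := det_transpose_mul_self_ne_zero (W := of fun u x => if u = s x then (1 : ℝ) else 0)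
      s fun x y => by simp
    by_contra hψ
    obtain ⟨z, hz⟩ := Function.ne_iff.1 hψ
    have hp : ∀ u x, (of fun u x => if u = s x then (1 : ℝ) else 0) u x ≠ 0 →
        u i = 0 ∧ u j = 1 := by
      intro u x hux
      have : u = s x := by
        by_contra hn
        simp [hn] at hux
      rw [this]
      exact hs x
    have hz1 := (of_ne_zero_of_localOp_complOp hdet _ h1 hp hz).1
    have hz2 := (of_ne_zero_of_localOp_complOp hdet _ h2 hp hz).2
    simp only [Function.comp_apply, hσij, Function.Embedding.inl_apply] at hz1 hz2
    rw [hz1] at hz2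
    exact absurd hz2 (by decide)
  · push Not at hcase
    obtain rfl := hcase _ _ h₀
    obtain ⟨a, ha⟩ : ∃ a, σ a ≠ Sum.inl a := by
      by_contra hn
      push Not at hn
      exact hne (Function.Embedding.ext hn)
    have hai : i₀ ≠ a := by
      rintro rfl
      exact ha h₀
    have hσa : ∀ b, σ a ≠ Sum.inl b := by
      intro b hb
      obtain rfl := hcase _ _ hb
      exact ha hb
    -- Aligned but partial overlap: qubit `i₀` is common, while qubit `a` of the second block lies
    -- outside the first. The code is spanned by sums of a word and the word with bits `i₀` and `a`
    -- flipped; it has equal bits at `i₀` and `a` and is invariant under the flip. Flipping in the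
    -- first block preserves the amplitude but breaks the equality demanded by the second.
    obtain ⟨s, hs⟩ := exists_words h hai 0 0
    set W : Matrix (Fin N → Fin 2) (Fin d) ℝ :=
      of fun u x => if u = s x ∨ u = flipBits i₀ a (s x) then 1 else 0 with hWdef
    have hdet : (Wᵀ * W).det ≠ 0 := by
      refine det_transpose_mul_self_ne_zero s fun x y => ?_
      have : s x ≠ flipBits i₀ a (s y) := by
        intro heq
        have := congrFun heq i₀
        rw [(hs x).1, flipBits, if_pos (Or.inl rfl), (hs y).1] at this
        exact absurd this (by decide)
      simp [hWdef, this]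
    refine ⟨W, hdet, fun ψ h1 h2 => ?_⟩
    by_contra hψ
    obtain ⟨z, hz⟩ := Function.ne_iff.1 hψ
    have hp : ∀ u x, W u x ≠ 0 → u i₀ = u a := by
      intro u x hux
      have : u = s x ∨ u = flipBits i₀ a (s x) := by
        by_contra hn
        simp [hWdef, hn] at hux
      rcases this with rfl | rfl
      · rw [(hs x).1, (hs x).2]
      · simp [flipBits, hs x]
    have hτ : ∀ u x, W (flipBits i₀ a u) x = W u x := by
      intro u x
      simp only [hWdef, of_apply]
      refine if_congr ⟨fun h => ?_, fun h => ?_⟩ rfl rfl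
      · rcases h with h | h
        · exact Or.inr (by rw [← h, flipBits_flipBits])
        · exact Or.inl (by rw [← flipBits_flipBits i₀ a u, h, flipBits_flipBits])
      · rcases h with rfl | rfl
        · exact Or.inr rfl
        · exact Or.inl (flipBits_flipBits _ _ _)
    set z' := Function.extend (Function.Embedding.inl : Fin N ↪ Fin N ⊕ Fin N)
      (flipBits i₀ a (z ∘ (Function.Embedding.inl : Fin N ↪ Fin N ⊕ Fin N))) z with hz'
    have hz'0 : ψ z' ≠ 0 := by
      rw [hz', eq_of_localOp_complOp hdet _ h1 hτ]
      exact hz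
    have e1 := of_ne_zero_of_localOp_complOp hdet _ h2 hp hz
    have e2 := of_ne_zero_of_localOp_complOp hdet _ h2 hp hz'0
    simp only [Function.comp_apply, h₀] at e1 e2
    have e3 : z' (Sum.inl i₀) = z (Sum.inl i₀) + 1 := by
      rw [hz', ← Function.Embedding.inl_apply, Function.Embedding.inl.injective.extend_apply]
      simp [flipBits]
    have e4 : z' (σ a) = z (σ a) := by
      rw [hz', Function.extend_apply']
      rintro ⟨b, hb⟩
      exact hσa b hb.symm
    rw [e3, e4, ← e1] at e2
    revert e2
    generalize z (Sum.inl i₀) = b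
    revert b
    decide

/-- A Gram matrix whose kernel consists of the vectors killed by both local operators. -/
noncomputable def overlapGram {κ ι α R : Type*} [Fintype ι] [DecidableEq ι] [Fintype α]
    [CommRing R] (e₁ e₂ : κ ↪ ι) (A : Matrix (κ → α) (κ → α) R) : Matrix (ι → α) (ι → α) R :=
  (localOp e₁ A)ᵀ * localOp e₁ A + (localOp e₂ A)ᵀ * localOp e₂ A

theorem overlapGram_map {κ ι α R S : Type*} [Fintype ι] [DecidableEq ι] [Fintype α] [CommRing R]
    [CommRing S] (e₁ e₂ : κ ↪ ι) (f : R →+* S) (A : Matrix (κ → α) (κ → α) R) :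
    overlapGram e₁ e₂ (A.map f) = (overlapGram e₁ e₂ A).map f := by
  simp only [overlapGram, localOp_map _ f (map_zero f), Matrix.map_add f (map_add f),
    Matrix.map_mul, transpose_map]

/-- Over ℝ the quadratic form of the Gram matrix is the sum of two squared norms, so a kernel vector
is killed by both operators. -/
theorem overlapGram_det_ne_zero {κ ι α : Type*} [Fintype ι] [DecidableEq ι] [Fintype α]
    [DecidableEq α] {e₁ e₂ : κ ↪ ι} {A : Matrix (κ → α) (κ → α) ℝ}
    (h : ∀ ψ, localOp e₁ A *ᵥ ψ = 0 → localOp e₂ A *ᵥ ψ = 0 → ψ = 0) :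
    (overlapGram e₁ e₂ A).det ≠ 0 := by
  intro h0
  obtain ⟨v, hv, hv0⟩ := exists_mulVec_eq_zero_iff.2 h0
  have hsq : ∀ M : Matrix (ι → α) (ι → α) ℝ, v ⬝ᵥ ((Mᵀ * M) *ᵥ v) = (M *ᵥ v) ⬝ᵥ (M *ᵥ v) := by
    intro M
    rw [← Matrix.mulVec_mulVec, Matrix.dotProduct_mulVec, Matrix.vecMul_transpose]
  have h1 : v ⬝ᵥ (overlapGram e₁ e₂ A *ᵥ v) = 0 := by rw [hv0, dotProduct_zero]
  rw [overlapGram, Matrix.add_mulVec, dotProduct_add, hsq, hsq] at h1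
  have hnn : ∀ w : (ι → α) → ℝ, 0 ≤ w ⬝ᵥ w := fun w =>
    Finset.sum_nonneg fun i _ => mul_self_nonneg _
  have h2 := (add_eq_zero_iff_of_nonneg (hnn _) (hnn _)).1 h1
  exact hv (h v (dotProduct_self_eq_zero.1 h2.1) (dotProduct_self_eq_zero.1 h2.2))

/-- A code that is good for all overlaps. -/
theorem exists_generic_code {N d : ℕ} (hN : 2 ≤ N) (h : d ≤ 2 ^ (N - 2)) :
    ∃ W : Matrix (Fin N → Fin 2) (Fin d) ℝ, (Wᵀ * W).det ≠ 0 ∧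
      ∀ σ : Fin N ↪ Fin N ⊕ Fin N, IsOverlap σ →
        (overlapGram Function.Embedding.inl σ (complOp W)).det ≠ 0 := by
  classical
  -- A matrix of indeterminates, whose evaluations are all real matrices of this shape.
  set X : Matrix (Fin N → Fin 2) (Fin d) (MvPolynomial ((Fin N → Fin 2) × Fin d) ℝ) :=
    of fun u x => MvPolynomial.X (u, x) with hX
  have hev : ∀ w : (Fin N → Fin 2) × Fin d → ℝ,
      X.map (MvPolynomial.eval w) = of fun u x => w (u, x) := by
    intro w
    ext u x
    simp [hX]
  have hdet : ∀ w : (Fin N → Fin 2) × Fin d → ℝ, MvPolynomial.eval w (Xᵀ * X).det =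
      ((of fun u x => w (u, x))ᵀ * of fun u x => w (u, x)).det := by
    intro w
    rw [RingHom.map_det, RingHom.mapMatrix_apply, Matrix.map_mul, transpose_map, hev]
  have hgram : ∀ (w : (Fin N → Fin 2) × Fin d → ℝ) (σ : Fin N ↪ Fin N ⊕ Fin N),
      MvPolynomial.eval w (overlapGram Function.Embedding.inl σ (complOp X)).det =
        (overlapGram Function.Embedding.inl σ (complOp (of fun u x => w (u, x)))).det := by
    intro w σ
    rw [RingHom.map_det, RingHom.mapMatrix_apply, ← overlapGram_map, ← complOp_map, hev]
  have hofW : ∀ W : Matrix (Fin N → Fin 2) (Fin d) ℝ,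
      (of fun u x => (fun p : (Fin N → Fin 2) × Fin d => W p.1 p.2) (u, x)) = W := fun W => rfl
  set F := (Xᵀ * X).det * ∏ σ : {σ : Fin N ↪ Fin N ⊕ Fin N // IsOverlap σ},
    (overlapGram Function.Embedding.inl σ.1 (complOp X)).det with hF
  -- Each factor is nonzero at a witness of its own, and the polynomial ring has no zero divisors.
  have hF0 : F ≠ 0 := by
    refine mul_ne_zero ?_ (Finset.prod_ne_zero_iff.2 fun σ _ => ?_)
    · obtain ⟨s, -⟩ := exists_words h (i := ⟨0, by omega⟩) (j := ⟨1, by omega⟩) (by simp) 0 0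
      have h1 := det_transpose_mul_self_ne_zero
        (W := of fun u x => if u = s x then (1 : ℝ) else 0) s fun x y => by simp
      intro h0
      have h2 := hdet fun p => (of fun u x => if u = s x then (1 : ℝ) else 0) p.1 p.2
      rw [h0, map_zero, hofW] at h2
      exact h1 h2.symm
    · obtain ⟨W, h1, h2⟩ := exists_code_of_isOverlap h σ.2
      intro h0
      have h3 := hgram (fun p => W p.1 p.2) σ.1
      rw [h0, map_zero, hofW] at h3
      exact overlapGram_det_ne_zero h2 h3.symm
  obtain ⟨w, hw⟩ : ∃ w, MvPolynomial.eval w F ≠ 0 := by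
    by_contra hn
    push Not at hn
    exact hF0 (MvPolynomial.funext fun x => by rw [hn, map_zero])
  rw [hF, map_mul, map_prod] at hw
  refine ⟨of fun u x => w (u, x), ?_, fun σ hσ => ?_⟩
  · rw [← hdet]
    exact left_ne_zero_of_mul hw
  · rw [← hgram]
    exact Finset.prod_ne_zero_iff.1 (right_ne_zero_of_mul hw) ⟨σ, hσ⟩ (Finset.mem_univ _)

/-- The orthonormal basis of the range of a real matrix of full column rank, as a complex matrix. -/
theorem exists_isometry_of_det_ne_zero {m n : Type*} [Fintype m] [DecidableEq m] [Fintype n]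
    [DecidableEq n] {W : Matrix m n ℝ} (hW : (Wᵀ * W).det ≠ 0) :
    ∃ V : Matrix m n ℂ, Vᴴ * V = 1 ∧ (complOp W).map (algebraMap ℝ ℂ) * V = 0 := by
  set Wc := W.map (algebraMap ℝ ℂ) with hWc
  have hG : (Wcᴴ * Wc).det ≠ 0 := by
    have h1 : Wcᴴ * Wc = (Wᵀ * W).map (algebraMap ℝ ℂ) := by
      rw [Matrix.map_mul, hWc]
      congr 1
      ext i j
      simp
    rw [h1, ← RingHom.mapMatrix_apply, ← RingHom.map_det]
    simpa using hW
  -- Once the Gram matrix is written as `Bᴴ * B`, the columns of `Wc * B⁻¹` are orthonormal and span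
  -- the same space.
  obtain ⟨B, hB⟩ : ∃ B : Matrix n n ℂ, Wcᴴ * Wc = Bᴴ * B := by
    open scoped MatrixOrder in
    exact CStarAlgebra.nonneg_iff_eq_star_mul_self.1
      (posSemidef_conjTranspose_mul_self Wc).nonneg
  have hBdet : IsUnit B.det := by
    rw [isUnit_iff_ne_zero]
    intro h0
    rw [hB, det_mul, h0, mul_zero] at hG
    exact hG rfl
  refine ⟨Wc * B⁻¹, ?_, ?_⟩
  · rw [conjTranspose_mul, Matrix.mul_assoc, ← Matrix.mul_assoc Wcᴴ, hB, Matrix.mul_assoc Bᴴ,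
      Matrix.mul_nonsing_inv _ hBdet, Matrix.mul_one, ← conjTranspose_mul,
      Matrix.mul_nonsing_inv _ hBdet, conjTranspose_one]
  · rw [← complOp_map, ← Matrix.mul_assoc, complOp_mul_self, Matrix.zero_mul]

/-- There is a code such that no state is a code state on two overlapping, different blocks. -/
theorem exists_rigid_code {N d : ℕ} (hN : 2 ≤ N) (h : d ≤ 2 ^ (N - 2)) :
    ∃ V : Matrix (Fin N → Fin 2) (Fin d) ℂ, Vᴴ * V = 1 ∧
      ∀ (n : ℕ) (e₁ e₂ : Fin N ↪ Fin n), (∃ i j, e₁ i = e₂ j) → e₁ ≠ e₂ →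
        ∀ ψ : QuditVec 2 n, applyAt e₁ (1 - V * Vᴴ) *ᵥ ψ = 0 →
          applyAt e₂ (1 - V * Vᴴ) *ᵥ ψ = 0 → ψ = 0 := by
  obtain ⟨W, hW, hov⟩ := exists_generic_code hN h
  obtain ⟨V, hV, hWV⟩ := exists_isometry_of_det_ne_zero hW
  refine ⟨V, hV, fun n e₁ e₂ ⟨i₀, j₀, h₀⟩ hne ψ h1 h2 => ?_⟩
  set A := (complOp W).map (algebraMap ℝ ℂ) with hA
  -- `A` kills the range of `V`, so the code space condition on a block implies the one stated with
  -- `A`.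
  have hAV : A = A * (1 - V * Vᴴ) := by
    rw [Matrix.mul_sub, Matrix.mul_one, ← Matrix.mul_assoc, hWV, Matrix.zero_mul, sub_zero]
  have hk : ∀ e : Fin N ↪ Fin n, applyAt e (1 - V * Vᴴ) *ᵥ ψ = 0 → localOp e A *ᵥ ψ = 0 := by
    intro e he
    rw [hAV, localOp_mul, ← Matrix.mulVec_mulVec, ← applyAt_eq_localOp e (1 - V * Vᴴ), he,
      Matrix.mulVec_zero]
  have k1 := hk e₁ h1
  have k2 := hk e₂ h2
  classical
  -- the overlap of the two blocks
  set σf : Fin N → Fin N ⊕ Fin N :=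
    fun j => if hj : ∃ i, e₁ i = e₂ j then Sum.inl hj.choose else Sum.inr j with hσf
  have hσl : ∀ i j, e₁ i = e₂ j → σf j = Sum.inl i := by
    intro i j hij
    have hj : ∃ i, e₁ i = e₂ j := ⟨i, hij⟩
    simp only [hσf, dif_pos hj]
    rw [e₁.injective (hj.choose_spec.trans hij.symm)]
  have hσr : ∀ j, (¬ ∃ i, e₁ i = e₂ j) → σf j = Sum.inr j := fun j hj => by
    simp only [hσf, dif_neg hj]
  have hσinj : Function.Injective σf := by
    intro j j' hjj
    by_cases hj : ∃ i, e₁ i = e₂ j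
    · obtain ⟨i, hi⟩ := hj
      by_cases hj' : ∃ i, e₁ i = e₂ j'
      · obtain ⟨i', hi'⟩ := hj'
        rw [hσl _ _ hi, hσl _ _ hi'] at hjj
        obtain rfl := Sum.inl_injective hjj
        exact e₂.injective (hi.symm.trans hi')
      · rw [hσl _ _ hi, hσr _ hj'] at hjj
        exact absurd hjj (by simp)
    · by_cases hj' : ∃ i, e₁ i = e₂ j'
      · obtain ⟨i', hi'⟩ := hj'
        rw [hσr _ hj, hσl _ _ hi'] at hjj
        exact absurd hjj (by simp)
      · rw [hσr _ hj, hσr _ hj'] at hjj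
        exact Sum.inr_injective hjj
  set σ : Fin N ↪ Fin N ⊕ Fin N := ⟨σf, hσinj⟩ with hσ
  have hover : IsOverlap σ := by
    refine ⟨fun heq => hne (Function.Embedding.ext fun j => ?_), i₀, j₀, hσl _ _ h₀⟩
    have hj : σf j = Sum.inl j := congrArg (fun f : Fin N ↪ Fin N ⊕ Fin N => f j) heq
    by_cases hj' : ∃ i, e₁ i = e₂ j
    · obtain ⟨i, hi⟩ := hj'
      rw [hσl _ _ hi] at hj
      have hij : i = j := Sum.inl_injective hj
      rw [← hij, hi, hij]
    · rw [hσr _ hj'] at hj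
      exact absurd hj (by simp)
  have hdet : (overlapGram Function.Embedding.inl σ A).det ≠ 0 := by
    rw [hA, overlapGram_map, ← RingHom.mapMatrix_apply, ← RingHom.map_det]
    simpa using hov σ hover
  -- the state, as a function of the qubits of the two blocks
  funext z₀
  -- `ρ` reads a word on the overlap pattern as a word on all qubits, which is `z₀` outside the two
  -- blocks. A coordinate `Sum.inr j` whose qubit already lies in the first block is not used.
  set ρ : (Fin N ⊕ Fin N → Fin 2) → Fin n → Fin 2 := fun y =>
    Function.extend e₁ (y ∘ Sum.inl) (Function.extend e₂ (y ∘ Sum.inr) z₀) with hρ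
  have hρ1 : ∀ y i, ρ y (e₁ i) = y (Sum.inl i) := fun y i => by
    simp only [hρ, e₁.injective.extend_apply, Function.comp_apply]
  have hρ2 : ∀ y j, ρ y (e₂ j) = y (σ j) := by
    intro y j
    show _ = y (σf j)
    by_cases hj : ∃ i, e₁ i = e₂ j
    · obtain ⟨i, hi⟩ := hj
      rw [← hi, hρ1, hσl _ _ hi]
    · rw [hσr _ hj]
      simp only [hρ]
      rw [Function.extend_apply' _ _ _ hj, e₂.injective.extend_apply, Function.comp_apply]
  have hρ3 : ∀ y q, (¬ ∃ i, e₁ i = q) → (¬ ∃ j, e₂ j = q) → ρ y q = z₀ q := by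
    intro y q hq hq'
    simp only [hρ]
    rw [Function.extend_apply' _ _ _ hq, Function.extend_apply' _ _ _ hq']
  -- Overwriting a block commutes with `ρ`, so slices of `ψ` along a block give slices of `ψ ∘ ρ`
  -- along its image in the pattern.
  have hext : ∀ (e : Fin N ↪ Fin n) (e' : Fin N ↪ Fin N ⊕ Fin N)
      (_ : ∀ y i, ρ y (e i) = y (e' i)) (_ : ∀ i k, σ k = e' i → e₂ k = e i)
      (_ : ∀ i k, Sum.inl k = e' i → e₁ k = e i) (x y),
      ρ (Function.extend e' x y) = Function.extend e x (ρ y) := by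
    intro e e' he hs hl x y
    funext q
    by_cases hq : ∃ i, e i = q
    · obtain ⟨i, rfl⟩ := hq
      rw [he, e'.injective.extend_apply, e.injective.extend_apply]
    · rw [Function.extend_apply' _ _ _ hq]
      by_cases h1 : ∃ i, e₁ i = q
      · obtain ⟨i, rfl⟩ := h1
        rw [hρ1, hρ1, Function.extend_apply']
        rintro ⟨k, hk⟩
        exact hq ⟨k, (hl k i hk.symm).symm⟩
      · by_cases h2 : ∃ j, e₂ j = q
        · obtain ⟨j, rfl⟩ := h2
          rw [hρ2, hρ2, Function.extend_apply']
          rintro ⟨k, hk⟩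
          exact hq ⟨k, (hs k j hk.symm).symm⟩
        · rw [hρ3 _ _ h1 h2, hρ3 _ _ h1 h2]
  have key : (fun y => ψ (ρ y)) = 0 := by
    have hz : overlapGram Function.Embedding.inl σ A *ᵥ (fun y => ψ (ρ y)) = 0 := by
      have z1 : localOp Function.Embedding.inl A *ᵥ (fun y => ψ (ρ y)) = 0 := by
        rw [localOp_mulVec_eq_zero_iff] at k1 ⊢
        intro y
        rw [← k1 (ρ y)]
        congr 1
        funext x
        rw [hext e₁ Function.Embedding.inl hρ1 ?_ ?_]
        · intro i k hk
          by_cases hk' : ∃ i, e₁ i = e₂ k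
          · obtain ⟨i', hi'⟩ := hk'
            have := (hσl _ _ hi').symm.trans hk
            rw [← hi', Sum.inl_injective this]
          · exact absurd ((hσr _ hk').symm.trans hk) (by simp)
        · intro i k hk
          rw [Sum.inl_injective hk]
      have z2 : localOp σ A *ᵥ (fun y => ψ (ρ y)) = 0 := by
        rw [localOp_mulVec_eq_zero_iff] at k2 ⊢
        intro y
        rw [← k2 (ρ y)]
        congr 1
        funext x
        rw [hext e₂ σ hρ2 ?_ ?_]
        · intro i k hk
          rw [σ.injective hk]
        · intro i k hk
          by_cases hi' : ∃ k, e₁ k = e₂ i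
          · obtain ⟨k', hk'⟩ := hi'
            have := hk.trans (hσl _ _ hk')
            rw [Sum.inl_injective this, hk']
          · exact absurd (hk.trans (hσr _ hi')) (by simp)
      rw [overlapGram, Matrix.add_mulVec, ← Matrix.mulVec_mulVec, ← Matrix.mulVec_mulVec, z1, z2]
      simp
    by_contra hn
    exact hdet (exists_mulVec_eq_zero_iff.1 ⟨_, hn, hz⟩)
  -- The word `z₀` is itself a value of `ρ`, so the vanishing of `ψ ∘ ρ` gives `ψ z₀ = 0`.
  have hz0 : ρ (fun s => Sum.elim (fun i => z₀ (e₁ i)) (fun j => z₀ (e₂ j)) s) = z₀ := by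
    funext q
    by_cases h1 : ∃ i, e₁ i = q
    · obtain ⟨i, rfl⟩ := h1
      rw [hρ1]
      rfl
    · by_cases h2 : ∃ j, e₂ j = q
      · obtain ⟨j, rfl⟩ := h2
        rw [hρ2]
        show Sum.elim _ _ (σf j) = _
        rw [hσr _ h1]
        rfl
      · exact hρ3 _ _ h1 h2
  have := congrFun key (fun s => Sum.elim (fun i => z₀ (e₁ i)) (fun j => z₀ (e₂ j)) s)
  simpa [hz0] using this

end Rigid

/-! ### Predicates on bit strings decided by constant-depth circuits -/

/-- The predicates `b i` on bit strings are decided by circuits of constant depth and of size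
polynomial in the length of the string, uniformly in `i`. -/
def AC0Family {ι : Type*} (b : ι → List Bool → Prop) : Prop :=
  ∃ (D : ℕ) (P : Polynomial ℕ), ∀ i n, ∃ c : BoolCircuit n, c.depth ≤ D ∧ c.size ≤ P.eval n ∧
    ∀ x : Fin n → Bool, c.eval x = true ↔ b i (List.ofFn x)

theorem BoolCircuit.exists_or {n D S : ℕ} {τ : Type*} [Fintype τ] {b : τ → (Fin n → Bool) → Prop}
    (h : ∀ t, ∃ c : BoolCircuit n, c.depth ≤ D ∧ c.size ≤ S ∧ ∀ x, c.eval x = true ↔ b t x) :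
    ∃ c : BoolCircuit n, c.depth ≤ D + 1 ∧ c.size ≤ Fintype.card τ * S + 1 ∧
      ∀ x, c.eval x = true ↔ ∃ t, b t x := by
  choose c hD hS hc using h
  refine ⟨.or fun j => c ((Fintype.equivFin τ).symm j), ?_, ?_, fun x => ?_⟩
  · simp only [BoolCircuit.depth, add_le_add_iff_right, Finset.sup_le_iff]
    exact fun j _ => hD _
  · simp only [BoolCircuit.size, add_le_add_iff_right]
    calc _ ≤ ∑ _j : Fin (Fintype.card τ), S := Finset.sum_le_sum fun j _ => hS _
      _ = _ := by simp
  · simp only [BoolCircuit.eval, decide_eq_true_eq, hc]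
    exact ⟨fun ⟨j, hj⟩ => ⟨_, hj⟩,
      fun ⟨t, ht⟩ => ⟨Fintype.equivFin τ t, by rwa [Equiv.symm_apply_apply]⟩⟩

namespace AC0Family

variable {ι κ : Type*} {b b' : ι → List Bool → Prop}

theorem congr (h : AC0Family b) (hb : ∀ i s, b i s ↔ b' i s) : AC0Family b' := by
  have : b = b' := funext fun i => funext fun s => propext (hb i s)
  exact this ▸ h

/-- Circuit families are non-uniform, so an index computed from the length costs nothing: addresses
are hardwired. -/
theorem comp (h : AC0Family b) (g : κ → ℕ → ι) :
    AC0Family fun k s => b (g k s.length) s := by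
  obtain ⟨D, P, hc⟩ := h
  refine ⟨D, P, fun k n => ?_⟩
  obtain ⟨c, h1, h2, h3⟩ := hc (g k n) n
  exact ⟨c, h1, h2, fun x => by simpa using h3 x⟩

theorem of_length (r : ι → ℕ → Prop) : AC0Family fun i s => r i s.length := by
  refine ⟨1, 1, fun i n => ?_⟩
  by_cases h : r i n
  · exact ⟨.and (m := 0) Fin.elim0, by simp [BoolCircuit.depth], by simp [BoolCircuit.size],
      fun x => by simp [BoolCircuit.eval, h]⟩
  · exact ⟨.or (m := 0) Fin.elim0, by simp [BoolCircuit.depth], by simp [BoolCircuit.size],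
      fun x => by simp [BoolCircuit.eval, h]⟩

theorem getD : AC0Family fun (i : ℕ) s => s.getD i false = true := by
  refine ⟨1, 1, fun i n => ?_⟩
  by_cases h : i < n
  · exact ⟨.input ⟨i, h⟩, by simp [BoolCircuit.depth], by simp [BoolCircuit.size],
      fun x => by simp [BoolCircuit.eval, h]⟩
  · exact ⟨.or (m := 0) Fin.elim0, by simp [BoolCircuit.depth], by simp [BoolCircuit.size],
      fun x => by simp [BoolCircuit.eval, h]⟩

theorem not (h : AC0Family b) : AC0Family fun i s => ¬ b i s := by
  obtain ⟨D, P, hc⟩ := h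
  refine ⟨D + 1, P + 1, fun i n => ?_⟩
  obtain ⟨c, h1, h2, h3⟩ := hc i n
  refine ⟨.not c, by simpa [BoolCircuit.depth] using h1, by simpa [BoolCircuit.size] using h2,
    fun x => ?_⟩
  show _ ↔ ¬ b i (List.ofFn x)
  rw [← h3]
  simp [BoolCircuit.eval]

theorem exists_lt {b : ι → ℕ → List Bool → Prop} (h : AC0Family fun q : ι × ℕ => b q.1 q.2)
    (m : ℕ → ℕ) (M : Polynomial ℕ) (hm : ∀ n, m n ≤ M.eval n) :
    AC0Family fun i s => ∃ j, j < m s.length ∧ b i j s := by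
  obtain ⟨D, P, hc⟩ := h
  refine ⟨D + 1, M * P + 1, fun i n => ?_⟩
  obtain ⟨c, h1, h2, h3⟩ := BoolCircuit.exists_or (τ := Fin (m n)) fun j => hc (i, j) n
  refine ⟨c, h1, h2.trans ?_, fun x => ?_⟩
  · simpa using Nat.mul_le_mul_right _ (hm n)
  · rw [h3]
    show _ ↔ ∃ j, j < m (List.ofFn x).length ∧ b i j (List.ofFn x)
    rw [List.length_ofFn]
    exact ⟨fun ⟨j, hj⟩ => ⟨j, j.2, hj⟩, fun ⟨j, hj, h⟩ => ⟨⟨j, hj⟩, h⟩⟩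

theorem exists_le {b : ι → ℕ → List Bool → Prop} (h : AC0Family fun q : ι × ℕ => b q.1 q.2) :
    AC0Family fun i s => ∃ j, j ≤ s.length ∧ b i j s :=
  (h.exists_lt (fun n => n + 1) (Polynomial.X + 1) (by simp)).congr fun i s => by
    simp only [Nat.lt_succ_iff]

theorem exists_fintype {τ : Type*} [Fintype τ] {b : ι → τ → List Bool → Prop}
    (h : AC0Family fun q : ι × τ => b q.1 q.2) : AC0Family fun i s => ∃ t, b i t s := by
  obtain ⟨D, P, hc⟩ := h
  refine ⟨D + 1, Polynomial.C (Fintype.card τ) * P + 1, fun i n => ?_⟩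
  obtain ⟨c, h1, h2, h3⟩ := BoolCircuit.exists_or fun t => hc (i, t) n
  exact ⟨c, h1, by simpa using h2, h3⟩

theorem or (h : AC0Family b) (h' : AC0Family b') : AC0Family fun i s => b i s ∨ b' i s := by
  -- The two families become one, with common bounds, so that the disjunction is a quantifier over
  -- `Bool`.
  have : AC0Family fun (q : ι × Bool) s => if q.2 then b q.1 s else b' q.1 s := by
    obtain ⟨D, P, hc⟩ := h
    obtain ⟨D', P', hc'⟩ := h'
    refine ⟨max D D', P + P', fun ⟨i, t⟩ n => ?_⟩
    cases t
    · obtain ⟨c, h1, h2, h3⟩ := hc' i n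
      exact ⟨c, h1.trans (le_max_right _ _), h2.trans (by simp), by simpa using h3⟩
    · obtain ⟨c, h1, h2, h3⟩ := hc i n
      exact ⟨c, h1.trans (le_max_left _ _), h2.trans (by simp), by simpa using h3⟩
  exact (this.exists_fintype (b := fun i (t : Bool) s => if t then b i s else b' i s)).congr
    fun i s => by simp [or_comm]

theorem and (h : AC0Family b) (h' : AC0Family b') : AC0Family fun i s => b i s ∧ b' i s :=
  (h.not.or h'.not).not.congr fun i s => by tauto

theorem forall_le {b : ι → ℕ → List Bool → Prop} (h : AC0Family fun q : ι × ℕ => b q.1 q.2) :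
    AC0Family fun i s => ∀ j, j ≤ s.length → b i j s :=
  (h.not.exists_le (b := fun i j s => ¬ b i j s)).not.congr fun i s => by
    push Not
    rfl

end AC0Family

theorem isAC0_of_family {f : List Bool → List Bool} (len : ℕ → ℕ) (Q : Polynomial ℕ)
    (hQ : ∀ n, len n ≤ Q.eval n) (hf : ∀ s, (f s).length = len s.length)
    (h : AC0Family fun j s => (f s).getD j false = true) : IsAC0 f := by
  obtain ⟨D, P, hc⟩ := h
  choose c hD hS hc using hc
  refine ⟨D, Q * P, len, fun n j => c j n, fun n j => hD _ _, fun n => ?_, fun n x => ?_⟩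
  · calc ∑ j : Fin (len n), (c j n).size ≤ ∑ _j : Fin (len n), P.eval n :=
        Finset.sum_le_sum fun j _ => hS _ _
      _ = len n * P.eval n := by simp
      _ ≤ _ := by simpa using Nat.mul_le_mul_right _ (hQ n)
  · refine List.ext_getElem (by simp [hf]) fun j h1 h2 => ?_
    rw [List.getElem_ofFn, Bool.eq_iff_iff, hc]
    simp [h1]

theorem isAC0_const (t : List Bool) : IsAC0 fun _ => t :=
  isAC0_of_family (fun _ => t.length) (Polynomial.C t.length) (by simp) (fun _ => rfl)
    (AC0Family.of_length fun j _ => t.getD j false = true)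

/-! ### Functions that depend on the header of a string -/

/-- The string starts with `0^p 1^w 0`. -/
def HasHeader (q : ℕ × ℕ) (s : List Bool) : Prop :=
  (0 < q.2 ∧ q.1 + q.2 < s.length) ∧
    (∀ i, i ≤ s.length → i < q.1 → ¬ s.getD i false = true) ∧
    (∀ i, i ≤ s.length → i < q.2 → s.getD (q.1 + i) false = true) ∧
    ¬ s.getD (q.1 + q.2) false = true

/-- The first 1 ends the padding, and the next 0 ends the unary width. -/
theorem HasHeader.unique {q q' : ℕ × ℕ} {s : List Bool} (h : HasHeader q s)
    (h' : HasHeader q' s) : q = q' := by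
  obtain ⟨p, w⟩ := q
  obtain ⟨p', w'⟩ := q'
  obtain ⟨⟨h1, h2⟩, h3, h4, h5⟩ := h
  obtain ⟨⟨h1', h2'⟩, h3', h4', h5'⟩ := h'
  dsimp only at *
  have hp : p = p' := by
    rcases lt_trichotomy p p' with hlt | heq | hlt
    · exact absurd (h4 0 (by omega) h1) (h3' (p + 0) (by omega) hlt)
    · exact heq
    · exact absurd (h4' 0 (by omega) h1') (h3 (p' + 0) (by omega) hlt)
  subst hp
  rcases lt_trichotomy w w' with hlt | heq | hlt
  · exact absurd (h4' w (by omega) hlt) h5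
  · rw [heq]
  · exact absurd (h4 w' (by omega) hlt) h5'

theorem AC0Family.hasHeader : AC0Family HasHeader := by
  have h1 : AC0Family fun (q : ℕ × ℕ) s => 0 < q.2 ∧ q.1 + q.2 < s.length :=
    .of_length fun (q : ℕ × ℕ) n => 0 < q.2 ∧ q.1 + q.2 < n
  have h2 : AC0Family fun (r : (ℕ × ℕ) × ℕ) s => r.2 < r.1.1 → ¬ s.getD r.2 false = true :=
    ((AC0Family.of_length fun (r : (ℕ × ℕ) × ℕ) _ => ¬ r.2 < r.1.1).or
      (AC0Family.getD.comp fun (r : (ℕ × ℕ) × ℕ) _ => r.2).not).congr fun r s => by tauto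
  have h3 : AC0Family fun (r : (ℕ × ℕ) × ℕ) s => r.2 < r.1.2 → s.getD (r.1.1 + r.2) false = true :=
    ((AC0Family.of_length fun (r : (ℕ × ℕ) × ℕ) _ => ¬ r.2 < r.1.2).or
      (AC0Family.getD.comp fun (r : (ℕ × ℕ) × ℕ) _ => r.1.1 + r.2)).congr fun r s => by tauto
  exact h1.and ((h2.forall_le
    (b := fun q i s => i < q.1 → ¬ s.getD i false = true)).and ((h3.forall_le
    (b := fun q i s => i < q.2 → s.getD (q.1 + i) false = true)).and
      (AC0Family.getD.comp fun (q : ℕ × ℕ) _ => q.1 + q.2).not))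

/-- An output bit that is either a constant or a copy of an input bit. -/
def outBit (s : List Bool) : Bool ⊕ ℕ → Bool := Sum.elim id fun i => s.getD i false

theorem AC0Family.outBit : AC0Family fun a s => outBit s a = true := by
  refine ((AC0Family.of_length fun (a : Bool ⊕ ℕ) _ => a = Sum.inl true).or
    ((AC0Family.of_length fun (a : Bool ⊕ ℕ) _ => a.isRight = true).and
      (AC0Family.getD.comp fun (a : Bool ⊕ ℕ) _ => a.elim (fun _ => 0) id))).congr fun a s => ?_
  cases a <;> simp [_root_.outBit]

/-- A function whose output bits are constants or copies of input bits, chosen according to the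
length and the header of the input and to one predicate, is `AC⁰`. -/
theorem exists_isAC0_of_template (len : ℕ → ℕ) (Q : Polynomial ℕ) (hQ : ∀ n, len n ≤ Q.eval n)
    (T : Bool → ℕ → ℕ × ℕ → List (Bool ⊕ ℕ)) {bad : ℕ × ℕ → List Bool → Prop}
    (hbad : AC0Family bad) :
    ∃ f, IsAC0 f ∧ ∀ (s : List Bool) (q : ℕ × ℕ) (c : Bool), HasHeader q s →
      (c = true ↔ bad q s) → (T c s.length q).length = len s.length →
      f s = (T c s.length q).map (outBit s) := by
  classical
  set bit : ℕ × ℕ → ℕ → List Bool → Prop := fun q j s => HasHeader q s ∧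
    ((bad q s ∧ outBit s ((T true s.length q).getD j (Sum.inl false)) = true) ∨
      (¬ bad q s ∧ outBit s ((T false s.length q).getD j (Sum.inl false)) = true)) with hbit
  have hT : ∀ c, AC0Family fun (r : (ℕ × ℕ) × ℕ) s =>
      outBit s ((T c s.length r.1).getD r.2 (Sum.inl false)) = true := fun c =>
    AC0Family.outBit.comp fun (r : (ℕ × ℕ) × ℕ) n => (T c n r.1).getD r.2 (Sum.inl false)
  have hfam : AC0Family fun (r : (ℕ × ℕ) × ℕ) s => bit r.1 r.2 s := by
    have hb := hbad.comp fun (r : (ℕ × ℕ) × ℕ) _ => r.1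
    exact (AC0Family.hasHeader.comp fun (r : (ℕ × ℕ) × ℕ) _ => r.1).and
      ((hb.and (hT true)).or (hb.not.and (hT false)))
  -- The header is guessed by a disjunction over all `p` and `w`; by uniqueness only the true one
  -- contributes.
  have hfam2 : AC0Family fun (j : ℕ) s => ∃ p, p ≤ s.length ∧ ∃ w, w ≤ s.length ∧
      bit (p, w) j s := by
    refine AC0Family.exists_le (b := fun j p s => ∃ w, w ≤ s.length ∧ bit (p, w) j s) ?_
    refine AC0Family.exists_le (b := fun (q : ℕ × ℕ) w s => bit (q.2, w) q.1 s) ?_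
    exact hfam.comp fun (r : (ℕ × ℕ) × ℕ) _ => ((r.1.2, r.2), r.1.1)
  refine ⟨fun s => List.ofFn fun j : Fin (len s.length) =>
    decide (∃ p, p ≤ s.length ∧ ∃ w, w ≤ s.length ∧ bit (p, w) j s), ?_, ?_⟩
  · refine isAC0_of_family len Q hQ (fun s => by simp) ?_
    refine ((AC0Family.of_length fun (j : ℕ) n => j < len n).and hfam2).congr fun j s => ?_
    by_cases hj : j < len s.length
    · simp [hj]
    · simp [hj]
  · intro s q c hq hc hlen
    refine List.ext_getElem (by simp [hlen]) fun j h1 h2 => ?_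
    have hj : j < (T c s.length q).length := by simpa using h2
    rw [List.getElem_ofFn, List.getElem_map, Bool.eq_iff_iff, decide_eq_true_eq]
    have hb : bit q j s ↔ outBit s (T c s.length q)[j] = true := by
      cases c
      · have : ¬ bad q s := fun h => by simpa using hc.2 h
        simp [hbit, hq, this, hj]
      · have : bad q s := hc.1 rfl
        simp [hbit, hq, this, hj]
    rw [← hb]
    constructor
    · rintro ⟨p, _, w, _, h⟩
      have : (p, w) = q := h.1.unique hq
      rwa [this] at h
    · intro h
      have := hq.1.2
      exact ⟨q.1, by omega, q.2, by omega, h⟩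

/-! ### Reading and writing encodings of instances -/

theorem List.getD_flatMap_of_length {α β : Type*} {F : α → List β} {K : ℕ}
    (hF : ∀ a, (F a).length = K) (x : β) (y : α) {l : List α} {k t : ℕ} (hk : k < l.length)
    (ht : t < K) : (l.flatMap F).getD (K * k + t) x = (F (l.getD k y)).getD t x := by
  induction l generalizing k with
  | nil => simp at hk
  | cons a l ih =>
    rw [List.flatMap_cons]
    cases k with
    | zero => rw [Nat.mul_zero, Nat.zero_add, List.getD_append _ _ _ _ (by rwa [hF])]; simp
    | succ k =>
      rw [List.getD_append_right _ _ _ _ (by rw [hF, Nat.mul_succ]; omega), hF]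
      have : K * (k + 1) + t - K = K * k + t := by rw [Nat.mul_succ]; omega
      rw [this, ih (by simpa using hk)]
      simp

theorem List.length_flatMap_of_length {α β : Type*} {F : α → List β} {K : ℕ}
    (hF : ∀ a, (F a).length = K) (l : List α) : (l.flatMap F).length = l.length * K := by
  induction l with
  | nil => simp
  | cons a l ih => rw [List.flatMap_cons, List.length_append, ih, hF, List.length_cons]; ring

namespace QCSP

variable {d : ℕ}

theorem length_bits (w v : ℕ) : (bits w v).length = w := by simp [bits]

theorem getD_bits {w t : ℕ} (v : ℕ) (ht : t < w) : (bits w v).getD t false = v.testBit t := by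
  simp [bits, ht]

theorem bits_eq_map (w v : ℕ) : bits w v = (List.range w).map v.testBit :=
  List.ext_getElem (by simp [bits]) fun j h1 h2 => by simp [bits]

/-- The address of bit `0` of integer `j` of clause `c`, in an encoding with header `q` and
`R + 1` integers for each clause. -/
def fieldAddr (R : ℕ) (q : ℕ × ℕ) (c j : ℕ) : ℕ := q.1 + q.2 + 1 + q.2 * (1 + ((R + 1) * c + j))

/-- The number of clauses in an encoding of length `n`. -/
def clauseCount (R n : ℕ) (q : ℕ × ℕ) : ℕ := (n - (q.1 + q.2 + 1 + q.2)) / ((R + 1) * q.2)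

/-- All that the circuits use: the header, the number of clauses, which is determined by the length
and the header, and the address of every digit. -/
theorem Encodes.parse {C : QCSP d} {s : List Bool} {I : C.Instance} (h : C.Encodes s I) :
    ∃ (q : ℕ × ℕ) (v : List (ℕ → ℕ)), 0 < q.2 ∧ I.n < 2 ^ q.2 ∧ C.numTypes ≤ 2 ^ q.2 ∧
      List.Forall₂ C.Describes I.clauses v ∧ HasHeader q s ∧
      s.length = q.1 + q.2 + 1 + q.2 + v.length * ((C.maxArity + 1) * q.2) ∧
      clauseCount C.maxArity s.length q = v.length ∧
      (∀ t < q.2, s.getD (q.1 + q.2 + 1 + t) false = I.n.testBit t) ∧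
      ∀ c < v.length, ∀ j ≤ C.maxArity, ∀ t < q.2,
        s.getD (fieldAddr C.maxArity q c j + t) false = (v.getD c (fun _ => 0) j).testBit t := by
  obtain ⟨p, w, v, hw, hn, hT, hv, hs⟩ := h
  set R := C.maxArity with hR
  -- the body is a list of integers
  set us : List ℕ := I.n :: v.flatMap fun r => (List.range (R + 1)).map r with hus
  set A : List Bool := List.replicate p false ++ List.replicate w true ++ [false] with hA
  have hAl : A.length = p + w + 1 := by simp [hA, Nat.add_assoc]
  have hs' : s = A ++ us.flatMap (bits w) := by
    rw [hs, hus, List.flatMap_cons, List.flatMap_assoc, ← List.append_assoc]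
    simp only [List.flatMap_map]
  have husl : us.length = 1 + v.length * (R + 1) := by
    rw [hus, List.length_cons, List.length_flatMap_of_length (K := R + 1) (by simp)]
    ring
  have hlen : s.length = p + w + 1 + w + v.length * ((R + 1) * w) := by
    rw [hs', List.length_append, hAl, List.length_flatMap_of_length (length_bits w), husl]
    ring
  have hget : ∀ k < us.length, ∀ t < w,
      s.getD (p + w + 1 + (w * k + t)) false = (us.getD k 0).testBit t := by
    intro k hk t ht
    rw [hs', List.getD_append_right _ _ _ _ (by rw [hAl]; omega), hAl, Nat.add_sub_cancel_left,
      List.getD_flatMap_of_length (length_bits w) _ 0 hk ht, getD_bits _ ht]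
  have hgetA : ∀ i < p + w + 1, s.getD i false = A.getD i false := by
    intro i hi
    rw [hs', List.getD_append _ _ _ _ (by rwa [hAl])]
  refine ⟨(p, w), v, hw, hn, hT, hv, ⟨⟨hw, by dsimp only; omega⟩, fun i _ hi => ?_, fun i _ hi => ?_,
    ?_⟩, hlen, ?_, fun t ht => ?_, fun c hc j hj t ht => ?_⟩
  · dsimp only at hi
    rw [hgetA i (by omega), hA, List.append_assoc, List.getD_append _ _ _ _ (by simpa using hi)]
    simp [hi]
  · dsimp only at hi ⊢
    rw [hgetA _ (by omega), hA, List.append_assoc, List.getD_append_right _ _ _ _ (by simp),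
      List.length_replicate, Nat.add_sub_cancel_left, List.getD_append _ _ _ _ (by simpa using hi)]
    simp [hi]
  · dsimp only
    rw [hgetA _ (by omega), hA, List.getD_append_right _ _ _ _ (by simp)]
    simp
  · rw [clauseCount, hlen, Nat.add_sub_cancel_left]
    exact Nat.mul_div_cancel _ (Nat.mul_pos (Nat.succ_pos _) hw)
  · have := hget 0 (by omega) t ht
    rw [Nat.mul_zero, Nat.zero_add] at this
    rw [this]
    rfl
  · have hk : 1 + ((R + 1) * c + j) < us.length := by
      rw [husl]
      have : (R + 1) * (c + 1) ≤ (R + 1) * v.length := Nat.mul_le_mul_left _ hc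
      rw [Nat.mul_succ] at this
      rw [Nat.mul_comm v.length]
      omega
    have h1 := hget _ hk t ht
    have h2 : us.getD (1 + ((R + 1) * c + j)) 0 = v.getD c (fun _ => 0) j := by
      rw [hus, Nat.add_comm 1, List.getD_cons_succ,
        List.getD_flatMap_of_length (F := fun r : ℕ → ℕ => (List.range (R + 1)).map r)
          (K := R + 1) (by simp) _ (fun _ => 0) hc (by omega)]
      simp [Nat.lt_succ_iff.2 hj]
    rw [h2] at h1
    rw [← h1, fieldAddr, Nat.add_assoc (p + w + 1)]

/-- The output bits of an encoding of width `w` with `m` clauses, padded to length `len`. -/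
def outTemplate (len w R m : ℕ) (hdr : ℕ → Bool ⊕ ℕ) (fld : ℕ → ℕ → ℕ → Bool ⊕ ℕ) :
    List (Bool ⊕ ℕ) :=
  List.replicate (len - (w + 1 + w + m * ((R + 1) * w))) (Sum.inl false) ++
    List.replicate w (Sum.inl true) ++ [Sum.inl false] ++ (List.range w).map hdr ++
    (List.range m).flatMap fun c => (List.range (R + 1)).flatMap fun j =>
      (List.range w).map (fld c j)

theorem length_outTemplate {len w R m : ℕ} (h : w + 1 + w + m * ((R + 1) * w) ≤ len)
    (hdr : ℕ → Bool ⊕ ℕ) (fld : ℕ → ℕ → ℕ → Bool ⊕ ℕ) :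
    (outTemplate len w R m hdr fld).length = len := by
  have h1 : ∀ c, ((List.range (R + 1)).flatMap fun j => (List.range w).map (fld c j)).length =
      (R + 1) * w := by
    intro c
    rw [List.length_flatMap_of_length (K := w) (by simp), List.length_range]
  simp only [outTemplate, List.length_append, List.length_replicate, List.length_singleton,
    List.length_map, List.length_range, List.length_flatMap_of_length h1]
  omega

theorem encodes_outTemplate {C : QCSP d} {I : C.Instance} {s : List Bool} (len : ℕ) {w : ℕ}
    (hw : 0 < w) (hn : I.n < 2 ^ w) (hT : C.numTypes ≤ 2 ^ w) (v : ℕ → ℕ → ℕ) {m : ℕ}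
    (hv : List.Forall₂ C.Describes I.clauses ((List.range m).map v)) {hdr : ℕ → Bool ⊕ ℕ}
    (hhdr : ∀ t < w, outBit s (hdr t) = I.n.testBit t) {fld : ℕ → ℕ → ℕ → Bool ⊕ ℕ}
    (hfld : ∀ c < m, ∀ j ≤ C.maxArity, ∀ t < w, outBit s (fld c j t) = (v c j).testBit t) :
    C.Encodes ((outTemplate len w C.maxArity m hdr fld).map (outBit s)) I := by
  refine ⟨len - (w + 1 + w + m * ((C.maxArity + 1) * w)), w, (List.range m).map v, hw, hn, hT, hv, ?_⟩
  simp only [outTemplate, List.map_append, List.map_replicate, List.map_cons, List.map_nil,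
    List.map_map, List.map_flatMap, List.flatMap_map]
  congr 1
  · congr 1
    rw [bits_eq_map]
    exact List.map_congr_left fun t ht => hhdr t (List.mem_range.1 ht)
  · refine List.flatMap_congr fun c hc => List.flatMap_congr fun j hj => ?_
    rw [bits_eq_map]
    exact List.map_congr_left fun t ht => hfld c (List.mem_range.1 hc) j
      (Nat.lt_succ_iff.1 (List.mem_range.1 hj)) t (List.mem_range.1 ht)

theorem map_range_getD {α β : Type*} (v : List α) (a : α) (G : α → β) :
    (List.range v.length).map (fun c => G (v.getD c a)) = v.map G :=
  List.ext_getElem (by simp) fun j h1 h2 => by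
    have : j < v.length := by simpa using h1
    simp [this]

/-- Padding an encoding. -/
theorem Encodes.pad {C : QCSP d} {s : List Bool} {I : C.Instance} (h : C.Encodes s I) (p : ℕ) :
    C.Encodes (List.replicate p false ++ s) I := by
  obtain ⟨p', w, v, hw, hn, hT, hv, hs⟩ := h
  refine ⟨p + p', w, v, hw, hn, hT, hv, ?_⟩
  rw [hs, List.replicate_add]
  simp only [List.append_assoc]

/-- Every instance has an encoding. -/
theorem exists_encodes (C : QCSP d) (I : C.Instance) : ∃ s, C.Encodes s I := by
  classical
  -- Since k < 2 ^ k, the number of qudits plus the number of types plus one is a sufficient width.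
  have hlt : ∀ n m k : ℕ, n + m + 1 = k → n < 2 ^ k ∧ m ≤ 2 ^ k := by
    intro n m k hk
    have := Nat.lt_two_pow_self (n := k)
    omega
  obtain ⟨h1, h2⟩ := hlt I.n C.numTypes _ rfl
  refine ⟨_, 0, I.n + C.numTypes + 1, I.clauses.map fun c j =>
    if j = 0 then (c.type : ℕ) else if hj : j - 1 < C.arity c.type then c.qudits ⟨j - 1, hj⟩ else 0,
    Nat.succ_pos _, h1, h2, ?_, rfl⟩
  rw [List.forall₂_map_right_iff, List.forall₂_same]
  intro c _
  exact ⟨by simp, fun j => by simp⟩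

end QCSP

/-! ### The reduction to qubits, and the structure of qubit instances -/

namespace QCSP

open scoped MatrixOrder

variable {d : ℕ}

theorem Instance.ViolatedBy.mono {C : QCSP d} {I : C.Instance} {ε ε' : ℝ} (h : I.ViolatedBy ε)
    (hε : ε' ≤ ε) : I.ViolatedBy ε' :=
  fun ψ hψ => hε.trans (h ψ hψ)

section Reductions

variable {C : QCSP d} {N : ℕ} {V : Matrix (Fin N → Fin 2) (Fin d) ℂ} (hV : Vᴴ * V = 1)
  {P : ∀ i, QuditOp d (C.arity i)} (hP : ∀ i, IsStarProjection (P i))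

theorem maxArity_encoded : (C.encoded hV hP).maxArity = C.maxArity * N := by
  refine le_antisymm (Finset.sup_le fun i _ => ?_) ?_
  · exact Nat.mul_le_mul_right N (Finset.le_sup (f := C.arity) (Finset.mem_univ i))
  · rcases N.eq_zero_or_pos with h0 | hpos
    · simp [h0]
    · rw [← Nat.le_div_iff_mul_le hpos]
      refine Finset.sup_le fun i _ => ?_
      rw [Nat.le_div_iff_mul_le hpos]
      exact Finset.le_sup (f := (C.encoded hV hP).arity) (Finset.mem_univ i)

variable {δ : ℝ} (hδ : 0 < δ)
  (hPδ : ∀ i, (δ : ℂ) • C.op i ≤ P i ∧ (δ : ℂ) • P i ≤ C.op i)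

/-- The clauses of an instance, on qudits. -/
def Instance.places {C : QCSP d} (I : C.Instance) : List (Σ i, Fin (C.arity i) ↪ Fin I.n) :=
  I.clauses.map fun c => ⟨c.type, c.qudits⟩

theorem Instance.eq_placed {C : QCSP d} (I : C.Instance) :
    I = ⟨I.n, I.places.map (placedClause (Function.Embedding.refl _))⟩ := by
  cases I with
  | mk n cs =>
    congr 1
    simp only [places, List.map_map]
    exact (List.map_id cs).symm

/-- The instance of the encoded problem in which qudit `q` is the block of the qubits
`N * q, …, N * q + N - 1`. -/
noncomputable def Instance.encode (I : C.Instance) : (C.encoded hV hP).Instance :=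
  ⟨I.n * N, I.places.map (blockClause hV hP finProdFinEquiv.toEmbedding)⟩

/-- The integers of a clause of `Instance.encode`. -/
def encodeInts (N : ℕ) (r : ℕ → ℕ) (j : ℕ) : ℕ :=
  if j = 0 then r 0 else N * r ((j - 1) / N + 1) + (j - 1) % N

theorem describes_encode {n : ℕ} (c : Σ i, Fin (C.arity i) ↪ Fin n) {v : ℕ → ℕ}
    (h : C.Describes (placedClause (Function.Embedding.refl _) c) v) :
    (C.encoded hV hP).Describes (blockClause hV hP finProdFinEquiv.toEmbedding c)
      (encodeInts N v) := by
  obtain ⟨i, e⟩ := c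
  refine ⟨(if_pos rfl).trans h.1, ?_⟩
  show ∀ s : Fin (C.arity i * N), (if (s : ℕ) + 1 = 0 then v 0 else
    N * v (((s : ℕ) + 1 - 1) / N + 1) + ((s : ℕ) + 1 - 1) % N) =
      (blockEmb e finProdFinEquiv.toEmbedding s : Fin (n * N))
  intro s
  obtain ⟨⟨b, t⟩, rfl⟩ := finProdFinEquiv.surjective s
  have h1 : v (b + 1) = e b := h.2 b
  have hN : 0 < N := t.pos
  rw [blockEmb_apply, if_neg (Nat.succ_ne_zero _), Nat.add_sub_cancel]
  simp only [Equiv.coe_toEmbedding, finProdFinEquiv_apply_val]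
  rw [Nat.add_mul_div_left _ _ hN, Nat.div_eq_of_lt t.2, Nat.add_mul_mod_self_left,
    Nat.mod_eq_of_lt t.2, Nat.zero_add, h1, Nat.add_comm]

/-- The output length may depend only on the input length, not on the header; a constant multiple of
it has room for every encoding, and padding fills the rest. -/
theorem length_encode_le {l N w R m p : ℕ} (hN : 0 < N) (hw : 0 < w) :
    w + l + 1 + (w + l) + m * ((R * N + 1) * (w + l)) ≤
      N * (1 + l) * (p + w + 1 + w + m * ((R + 1) * w)) := by
  have h1 : w + l ≤ (1 + l) * w := by nlinarith
  have h2 : R * N + 1 ≤ N * (R + 1) := by nlinarith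
  have h3 : (R * N + 1) * (w + l) ≤ N * (1 + l) * ((R + 1) * w) := by
    calc _ ≤ N * (R + 1) * ((1 + l) * w) := Nat.mul_le_mul h2 h1
      _ = _ := by ring
  have h4 : m * ((R * N + 1) * (w + l)) ≤ N * (1 + l) * (m * ((R + 1) * w)) := by
    calc _ ≤ m * (N * (1 + l) * ((R + 1) * w)) := Nat.mul_le_mul_left _ h3
      _ = _ := by ring
  have h5 : w + l ≤ N * (1 + l) * w := by
    calc _ ≤ 1 * ((1 + l) * w) := by simpa using h1
      _ ≤ N * ((1 + l) * w) := Nat.mul_le_mul_right _ hN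
      _ = _ := by ring
  have h6 : 1 ≤ N * (1 + l) := Nat.mul_pos hN (by omega)
  calc _ ≤ N * (1 + l) * w + N * (1 + l) + N * (1 + l) * w + N * (1 + l) * (m * ((R + 1) * w)) := by
        omega
    _ ≤ N * (1 + l) * p +
        (N * (1 + l) * w + N * (1 + l) + N * (1 + l) * w + N * (1 + l) * (m * ((R + 1) * w))) :=
        Nat.le_add_left _ _
    _ = _ := by ring

theorem testBit_two_pow_mul_add_of_lt {l a r t : ℕ} (hr : r < 2 ^ l) :
    (2 ^ l * a + r).testBit t = if t < l then r.testBit t else a.testBit (t - l) :=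
  Nat.testBit_two_pow_mul_add a hr t

/-- The bits of the number of qubits, when each of the qudits becomes `2 ^ l` qubits. -/
def encodeHdr (l : ℕ) (q : ℕ × ℕ) (t : ℕ) : Bool ⊕ ℕ :=
  if t < l then Sum.inl false else Sum.inr (q.1 + q.2 + 1 + (t - l))

/-- The bits of the type and of the qubits of a clause, when each of the qudits becomes `2 ^ l`
qubits. -/
def encodeFld (l R : ℕ) (q : ℕ × ℕ) (c j t : ℕ) : Bool ⊕ ℕ :=
  if j = 0 then (if t < q.2 then Sum.inr (fieldAddr R q c 0 + t) else Sum.inl false)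
  else if t < l then Sum.inl (((j - 1) % 2 ^ l).testBit t)
  else Sum.inr (fieldAddr R q c ((j - 1) / 2 ^ l + 1) + (t - l))

/-- Qubit `i` of the block of qudit `x` has number `2 ^ l * x + i`, with `i < 2 ^ l`: the digits of
`i` are constants and those of `x` are copied, shifted by `l`. The type is copied unshifted; its
bound makes the `l` additional digits zero. -/
theorem outBit_encodeFld {l R : ℕ} {q : ℕ × ℕ} {c : ℕ} {s : List Bool} {r : ℕ → ℕ}
    (hr : ∀ j ≤ R, ∀ t < q.2, s.getD (fieldAddr R q c j + t) false = (r j).testBit t)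
    (h0 : r 0 < 2 ^ q.2) {j t : ℕ} (hj : j ≤ R * 2 ^ l) (ht : t < q.2 + l) :
    outBit s (encodeFld l R q c j t) =
      (encodeInts (2 ^ l) r j).testBit t := by
  unfold encodeFld encodeInts
  by_cases hj0 : j = 0
  · rw [if_pos hj0, if_pos hj0]
    by_cases htw : t < q.2
    · rw [if_pos htw, ← hr 0 (Nat.zero_le _) t htw]
      rfl
    · rw [if_neg htw,
        Nat.testBit_lt_two_pow (h0.trans_le (Nat.pow_le_pow_right two_pos (not_lt.1 htw)))]
      rfl
  · rw [if_neg hj0, if_neg hj0,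
      testBit_two_pow_mul_add_of_lt (Nat.mod_lt _ (Nat.two_pow_pos l))]
    have hjN : (j - 1) / 2 ^ l + 1 ≤ R := by
      have : (j - 1) / 2 ^ l < R := by
        rw [Nat.div_lt_iff_lt_mul (Nat.two_pow_pos l)]
        omega
      omega
    by_cases htl : t < l
    · rw [if_pos htl, if_pos htl]
      rfl
    · rw [if_neg htl, if_neg htl, ← hr _ hjN (t - l) (by omega)]
      rfl

/-- Encoding is `AC⁰`: an address of `w` bits becomes one of `w + l` bits. -/
theorem exists_isAC0_encode {l : ℕ} (hN : N = 2 ^ l) :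
    ∃ f, IsAC0 f ∧ ∀ s (I : C.Instance), C.Encodes s I →
      (C.encoded hV hP).Encodes (f s) (I.encode hV hP) := by
  have hNpos : 0 < N := hN ▸ Nat.two_pow_pos l
  obtain ⟨R, hR⟩ : ∃ R, C.maxArity = R := ⟨_, rfl⟩
  have hR' : (C.encoded hV hP).maxArity = R * N := by rw [maxArity_encoded, hR]
  obtain ⟨f, hf, hfT⟩ := exists_isAC0_of_template (fun n => N * (1 + l) * n)
    (Polynomial.C (N * (1 + l)) * Polynomial.X) (by simp)
    (fun _ n q => outTemplate (N * (1 + l) * n) (q.2 + l) (R * N) (clauseCount R n q)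
      (encodeHdr l q) (encodeFld l R q))
    (AC0Family.of_length fun (_ : ℕ × ℕ) _ => False)
  refine ⟨f, hf, fun s I hs => ?_⟩
  obtain ⟨q, v, hw, hn, hTy, hv, hh, hlen, hcnt, hbn, hbv⟩ := hs.parse
  rw [hR] at hlen hcnt hbv
  rw [hfT s q false hh (by simp) (length_outTemplate (by
    rw [hcnt, hlen]
    exact length_encode_le hNpos hw) _ _), ← hR', hcnt]
  have hpow : 2 ^ q.2 ≤ 2 ^ (q.2 + l) := Nat.pow_le_pow_right two_pos (by omega)
  have hn' : (I.encode hV hP).n < 2 ^ (q.2 + l) := by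
    show I.n * N < _
    rw [Nat.pow_add, hN]
    exact Nat.mul_lt_mul_of_pos_right hn (Nat.two_pow_pos l)
  have hv' : List.Forall₂ (C.encoded hV hP).Describes (I.encode hV hP).clauses
      ((List.range v.length).map fun c => encodeInts N (v.getD c fun _ => 0)) := by
    rw [map_range_getD v _ (encodeInts N)]
    have h2 : I.clauses = I.places.map (placedClause (Function.Embedding.refl _)) := by
      simp only [Instance.places, List.map_map]
      exact (List.map_id _).symm
    rw [h2, List.forall₂_map_left_iff] at hv
    exact List.forall₂_map_left_iff.2 (List.forall₂_map_right_iff.2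
      (hv.imp fun c r h => describes_encode hV hP c h))
  refine encodes_outTemplate _ (Nat.add_pos_left hw _) hn' (le_trans hTy hpow) _ hv'
    (fun t ht => ?_) (fun c hc j hj t ht => ?_)
  · have h1 : (I.encode hV hP).n = 2 ^ l * I.n + 0 := by
      show I.n * N = _
      rw [hN, Nat.mul_comm, Nat.add_zero]
    rw [h1, testBit_two_pow_mul_add_of_lt (Nat.two_pow_pos l), encodeHdr]
    by_cases htl : t < l
    · simp [htl, outBit]
    · rw [if_neg htl, if_neg htl, ← hbn (t - l) (by omega)]
      rfl
  · have hlt : v.getD c (fun _ => 0) 0 < 2 ^ q.2 := by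
      have hcl : c < I.clauses.length := by rw [hv.length_eq]; exact hc
      have := (hv.get hcl hc).1
      simp only [List.get_eq_getElem] at this
      rw [List.getD_eq_getElem _ _ hc, this]
      exact lt_of_lt_of_le (Fin.is_lt _) hTy
    subst hN
    rw [hR'] at hj
    exact outBit_encodeFld (hbv c hc) hlt hj ht

include hδ hPδ in
theorem exists_reduces_encoded (hd : 0 < d) {l : ℕ} (hN : N = 2 ^ l) :
    ∃ f, IsAC0 f ∧ Reduces f C (C.encoded hV hP) := by
  obtain ⟨f, hf, hfe⟩ := exists_isAC0_encode hV hP hN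
  refine ⟨f, hf, δ, hδ, fun s I hs => ⟨I.encode hV hP, hfe s I hs, ?_, fun ε _ _ h => ?_⟩⟩
  · rw [Instance.encode, satisfiable_block_iff hV hP (Function.Embedding.refl _) _ _ hδ hPδ hd,
      ← I.eq_placed]
  · rw [I.eq_placed] at h
    exact violatedBy_block_of_placed hV hP (Function.Embedding.refl _) _ _ hδ hPδ hd h

/-! ### Decoding -/

/-- Two blocks of clauses that have a qubit in common agree. -/
def NoOverlap {n : ℕ} (cs : List ((C.encoded hV hP).Clause n)) : Prop :=
  ∀ c ∈ cs, ∀ c' ∈ cs, ∀ (b : Fin (C.arity c.type)) (b' : Fin (C.arity c'.type)) (i j k : Fin N),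
    c.qudits (finProdFinEquiv (b, i)) = c'.qudits (finProdFinEquiv (b', j)) →
      c.qudits (finProdFinEquiv (b, k)) = c'.qudits (finProdFinEquiv (b', k))

/-- A satisfying state is a code state on every block of every clause, so rigidity forces blocks
that meet to coincide. -/
theorem noOverlap_of_satisfiable {I : (C.encoded hV hP).Instance}
    (hrigid : ∀ (n : ℕ) (e₁ e₂ : Fin N ↪ Fin n), (∃ i j, e₁ i = e₂ j) → e₁ ≠ e₂ →
        ∀ ψ : QuditVec 2 n, applyAt e₁ (1 - V * Vᴴ) *ᵥ ψ = 0 →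
          applyAt e₂ (1 - V * Vᴴ) *ᵥ ψ = 0 → ψ = 0)
    (hI : I.Satisfiable) : NoOverlap hV hP I.clauses := by
  obtain ⟨ψ, hψ, hc⟩ := hI
  intro c hcm c' hcm' b b' i j k hij
  by_contra hk
  have := hrigid I.n _ _ ⟨i, j, hij⟩
    (fun he => hk (congrArg (fun e : Fin N ↪ Fin I.n => e k) he)) ψ
    (block_mulVec_eq_zero hV hP c (hc c hcm) b) (block_mulVec_eq_zero hV hP c' (hc c' hcm') b')
  rw [this] at hψ
  simp at hψ

/-- An instance without overlaps is made of disjoint blocks, indexed by their first qubits. -/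
theorem exists_blocks_of_noOverlap {I : (C.encoded hV hP).Instance} (hN : 0 < N)
    (h : NoOverlap hV hP I.clauses) :
    ∃ (p : Fin I.n → Prop) (B : {x // p x} × Fin N ↪ Fin I.n)
      (L : List (Σ i, Fin (C.arity i) ↪ {x // p x})),
      (∀ x, B (x, ⟨0, hN⟩) = x) ∧ I = ⟨I.n, L.map (blockClause hV hP B)⟩ := by
  classical
  set p : Fin I.n → Prop := fun x => ∃ c ∈ I.clauses, ∃ b : Fin (C.arity c.type),
    c.qudits (finProdFinEquiv (b, ⟨0, hN⟩)) = x with hp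
  -- One representative block for each first qubit.
  choose c hc b hb using fun x : {x // p x} => x.2
  have hB : Function.Injective fun y : {x // p x} × Fin N =>
      (c y.1).qudits (finProdFinEquiv (b y.1, y.2)) := by
    rintro ⟨x, t⟩ ⟨x', t'⟩ hxt
    dsimp only at hxt
    -- Blocks sharing a qubit agree at every position, in particular at position 0.
    have hx : x = x' := by
      refine Subtype.ext ?_
      rw [← hb x, ← hb x']
      exact h _ (hc x) _ (hc x') _ _ _ _ _ hxt
    subst hx
    have := (finProdFinEquiv.injective ((c x).qudits.injective hxt))
    rw [(Prod.mk.inj this).2]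
  set B : {x // p x} × Fin N ↪ Fin I.n := ⟨_, hB⟩ with hBdef
  set F : {c // c ∈ I.clauses} → (Σ i, Fin (C.arity i) ↪ {x // p x}) := fun c =>
    ⟨c.1.type, ⟨fun b => ⟨c.1.qudits (finProdFinEquiv (b, ⟨0, hN⟩)), c.1, c.2, b, rfl⟩,
      fun b b' hbb => (Prod.mk.inj (finProdFinEquiv.injective
        (c.1.qudits.injective (Subtype.mk.inj hbb)))).1⟩⟩ with hF
  refine ⟨p, B, I.clauses.attach.map F, fun x => hb x, ?_⟩
  have hcl : I.clauses = (I.clauses.attach.map F).map (blockClause hV hP B) := by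
    rw [List.map_map]
    conv_lhs => rw [← List.attach_map_subtype_val I.clauses]
    refine List.map_congr_left fun a _ => ?_
    obtain ⟨⟨i, e⟩, ha⟩ := a
    show (⟨i, e⟩ : (C.encoded hV hP).Clause I.n) = ⟨i, _⟩
    congr 1
    refine Function.Embedding.ext fun s => ?_
    obtain ⟨⟨b', t⟩, rfl⟩ := finProdFinEquiv.surjective s
    refine Eq.trans ?_ (blockEmb_apply (F ⟨⟨i, e⟩, ha⟩).2 B b' t).symm
    set x := (F ⟨⟨i, e⟩, ha⟩).2 b' with hx
    -- The representative and the given block share their first qubit, hence all qubits.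
    exact (h _ (hc x) _ ha (b x) b' ⟨0, hN⟩ ⟨0, hN⟩ t (hb x)).symm
  cases I with
  | mk n cs => exact congrArg _ hcl

end Reductions

end QCSP

/-! ### Detecting overlaps, and the reduction back to qudits -/

theorem AC0Family.iff {ι : Type*} {b b' : ι → List Bool → Prop} (h : AC0Family b)
    (h' : AC0Family b') : AC0Family fun i s => b i s ↔ b' i s :=
  ((h.and h').or (h.not.and h'.not)).congr fun i s => by tauto

/-- The `w` bits at `a` are those at `a'`. -/
def SameBits (q : ℕ × ℕ × ℕ) (s : List Bool) : Prop :=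
  ∀ t, t ≤ s.length → t < q.1 → (s.getD (q.2.1 + t) false = true ↔ s.getD (q.2.2 + t) false = true)

/-- The `w` bits at `a` are those of `x`. -/
def HasBits (q : ℕ × ℕ × ℕ) (s : List Bool) : Prop :=
  ∀ t, t ≤ s.length → t < q.1 → (s.getD (q.2.1 + t) false = true ↔ q.2.2.testBit t = true)

theorem AC0Family.sameBits : AC0Family SameBits := by
  refine AC0Family.forall_le (b := fun (q : ℕ × ℕ × ℕ) t s => t < q.1 →
    (s.getD (q.2.1 + t) false = true ↔ s.getD (q.2.2 + t) false = true)) ?_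
  refine ((AC0Family.of_length fun (r : (ℕ × ℕ × ℕ) × ℕ) _ => ¬ r.2 < r.1.1).or
    ((AC0Family.getD.comp fun (r : (ℕ × ℕ × ℕ) × ℕ) _ => r.1.2.1 + r.2).iff
      (AC0Family.getD.comp fun (r : (ℕ × ℕ × ℕ) × ℕ) _ => r.1.2.2 + r.2))).congr fun r s => ?_
  tauto

theorem AC0Family.hasBits : AC0Family HasBits := by
  refine AC0Family.forall_le (b := fun (q : ℕ × ℕ × ℕ) t s => t < q.1 →
    (s.getD (q.2.1 + t) false = true ↔ q.2.2.testBit t = true)) ?_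
  refine ((AC0Family.of_length fun (r : (ℕ × ℕ × ℕ) × ℕ) _ => ¬ r.2 < r.1.1).or
    ((AC0Family.getD.comp fun (r : (ℕ × ℕ × ℕ) × ℕ) _ => r.1.2.1 + r.2).iff
      (AC0Family.of_length fun (r : (ℕ × ℕ × ℕ) × ℕ) _ => r.1.2.2.testBit r.2 = true))).congr
    fun r s => ?_
  tauto

namespace QCSP

open scoped MatrixOrder

variable {d : ℕ}

/-- The circuit-level description of two overlapping blocks that differ: for some clauses of types
`τ` and `τ'`, qubit `i` of block `b` is qubit `j` of block `b'`, but the qubits `k` are not the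
same. -/
def HasOverlap (C : QCSP d) (N : ℕ) (q : ℕ × ℕ) (s : List Bool) : Prop :=
  ∃ c, c ≤ s.length ∧ ∃ c', c' ≤ s.length ∧
    ∃ u : (Σ i, Fin (C.arity i)) × (Σ i, Fin (C.arity i)) × Fin N × Fin N × Fin N,
      (c < clauseCount (C.maxArity * N) s.length q ∧ c' < clauseCount (C.maxArity * N) s.length q) ∧
      (HasBits (q.2, fieldAddr (C.maxArity * N) q c 0, u.1.1) s ∧
        HasBits (q.2, fieldAddr (C.maxArity * N) q c' 0, u.2.1.1) s) ∧
      SameBits (q.2, fieldAddr (C.maxArity * N) q c (u.2.2.1 + N * u.1.2 + 1),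
        fieldAddr (C.maxArity * N) q c' (u.2.2.2.1 + N * u.2.1.2 + 1)) s ∧
      ¬ SameBits (q.2, fieldAddr (C.maxArity * N) q c (u.2.2.2.2 + N * u.1.2 + 1),
        fieldAddr (C.maxArity * N) q c' (u.2.2.2.2 + N * u.2.1.2 + 1)) s

/-- Pairs of clauses are polynomially many, types and positions are constantly many, and equality of
two fields is a conjunction over their digits. -/
theorem ac0Family_hasOverlap (C : QCSP d) (N : ℕ) : AC0Family (HasOverlap C N) := by
  set R := C.maxArity * N with hR
  set Υ := (Σ i, Fin (C.arity i)) × (Σ i, Fin (C.arity i)) × Fin N × Fin N × Fin N with hΥ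
  refine AC0Family.exists_le (b := fun (q : ℕ × ℕ) c s => _) ?_
  refine AC0Family.exists_le (b := fun (r : (ℕ × ℕ) × ℕ) c' s => _) ?_
  refine AC0Family.exists_fintype (b := fun (r : ((ℕ × ℕ) × ℕ) × ℕ) (u : Υ) s => _) ?_
  exact (AC0Family.of_length fun (r : (((ℕ × ℕ) × ℕ) × ℕ) × Υ) n =>
      r.1.1.2 < clauseCount R n r.1.1.1 ∧ r.1.2 < clauseCount R n r.1.1.1).and
    (((AC0Family.hasBits.comp fun (r : (((ℕ × ℕ) × ℕ) × ℕ) × Υ) _ =>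
        (r.1.1.1.2, fieldAddr R r.1.1.1 r.1.1.2 0, (r.2.1.1 : ℕ))).and
      (AC0Family.hasBits.comp fun (r : (((ℕ × ℕ) × ℕ) × ℕ) × Υ) _ =>
        (r.1.1.1.2, fieldAddr R r.1.1.1 r.1.2 0, (r.2.2.1.1 : ℕ)))).and
    ((AC0Family.sameBits.comp fun (r : (((ℕ × ℕ) × ℕ) × ℕ) × Υ) _ =>
        (r.1.1.1.2, fieldAddr R r.1.1.1 r.1.1.2 (r.2.2.2.1 + N * r.2.1.2 + 1),
          fieldAddr R r.1.1.1 r.1.2 (r.2.2.2.2.1 + N * r.2.2.1.2 + 1))).and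
      (AC0Family.sameBits.comp fun (r : (((ℕ × ℕ) × ℕ) × ℕ) × Υ) _ =>
        (r.1.1.1.2, fieldAddr R r.1.1.1 r.1.1.2 (r.2.2.2.2.2 + N * r.2.1.2 + 1),
          fieldAddr R r.1.1.1 r.1.2 (r.2.2.2.2.2 + N * r.2.2.1.2 + 1))).not))

theorem hasBits_iff {s : List Bool} {w a x x' : ℕ} (hw : w ≤ s.length) (hx : x < 2 ^ w)
    (hx' : x' < 2 ^ w) (ha : ∀ t < w, s.getD (a + t) false = x.testBit t) :
    HasBits (w, a, x') s ↔ x = x' := by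
  constructor
  · intro h
    refine Nat.eq_of_testBit_eq fun t => ?_
    by_cases ht : t < w
    · rw [← ha t ht, Bool.eq_iff_iff]
      exact h t (by omega) ht
    · have hle : 2 ^ w ≤ 2 ^ t := Nat.pow_le_pow_right two_pos (not_lt.1 ht)
      rw [Nat.testBit_lt_two_pow (hx.trans_le hle), Nat.testBit_lt_two_pow (hx'.trans_le hle)]
  · rintro rfl t _ ht
    rw [← ha t ht]

theorem sameBits_iff {s : List Bool} {w a a' x x' : ℕ} (hw : w ≤ s.length) (hx : x < 2 ^ w)
    (hx' : x' < 2 ^ w) (ha : ∀ t < w, s.getD (a + t) false = x.testBit t)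
    (ha' : ∀ t < w, s.getD (a' + t) false = x'.testBit t) :
    SameBits (w, a, a') s ↔ x = x' := by
  rw [← hasBits_iff hw hx hx' ha]
  exact forall_congr' fun t => forall_congr' fun _ => forall_congr' fun ht => by
    rw [← ha' t ht]

section Decode

variable {C : QCSP d} {N : ℕ} {V : Matrix (Fin N → Fin 2) (Fin d) ℂ} (hV : Vᴴ * V = 1)
  {P : ∀ i, QuditOp d (C.arity i)} (hP : ∀ i, IsStarProjection (P i))

/-- All numbers involved are below `2 ^ w`, so comparing `w` digits decides equality. The bound on
`s.length` ensures that the bounded quantifiers of the circuit reach every clause and digit. -/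
theorem hasOverlap_iff {I : (C.encoded hV hP).Instance} {q : ℕ × ℕ} {s : List Bool}
    {v : List (ℕ → ℕ)} (hn : I.n < 2 ^ q.2) (hTy : C.numTypes ≤ 2 ^ q.2)
    (hv : List.Forall₂ (C.encoded hV hP).Describes I.clauses v)
    (hlen : q.2 + v.length ≤ s.length)
    (hcnt : clauseCount (C.maxArity * N) s.length q = v.length)
    (hbv : ∀ c < v.length, ∀ j ≤ C.maxArity * N, ∀ t < q.2,
      s.getD (fieldAddr (C.maxArity * N) q c j + t) false =
        (v.getD c (fun _ => 0) j).testBit t) :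
    HasOverlap C N q s ↔ ¬ NoOverlap hV hP I.clauses := by
  set R := C.maxArity * N with hR
  have hwl : q.2 ≤ s.length := by omega
  have hlc : I.clauses.length = v.length := hv.length_eq
  have htype : ∀ c (hc : c < v.length),
      v.getD c (fun _ => 0) 0 = ((I.clauses[c]'(hlc ▸ hc)).type : ℕ) := by
    intro c hc
    rw [List.getD_eq_getElem _ _ hc]
    exact (hv.get (hlc ▸ hc) hc).1
  have hqud : ∀ c (hc : c < v.length) (b : Fin (C.arity (I.clauses[c]'(hlc ▸ hc)).type))
      (i : Fin N), v.getD c (fun _ => 0) (i + N * b + 1) =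
        ((I.clauses[c]'(hlc ▸ hc)).qudits (finProdFinEquiv (b, i)) : ℕ) := by
    intro c hc b i
    rw [List.getD_eq_getElem _ _ hc]
    exact (hv.get (hlc ▸ hc) hc).2 (finProdFinEquiv (b, i))
  have hle : ∀ (τ : Fin C.numTypes) (b : Fin (C.arity τ)) (i : Fin N),
      (i : ℕ) + N * b + 1 ≤ R := by
    intro τ b i
    have h1 : C.arity τ ≤ C.maxArity := Finset.le_sup (f := C.arity) (Finset.mem_univ τ)
    have h2 : ((finProdFinEquiv (b, i) : Fin (C.arity τ * N)) : ℕ) < C.arity τ * N := Fin.is_lt _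
    rw [finProdFinEquiv_apply_val] at h2
    exact h2.trans_le (Nat.mul_le_mul_right N h1)
  have hT : ∀ c (hc : c < v.length) (τ : Fin C.numTypes),
      HasBits (q.2, fieldAddr R q c 0, (τ : ℕ)) s ↔ (I.clauses[c]'(hlc ▸ hc)).type = τ := by
    intro c hc τ
    rw [hasBits_iff hwl ?_ (lt_of_lt_of_le τ.2 hTy) (hbv c hc 0 (Nat.zero_le _)), htype c hc]
    · exact Fin.val_inj
    · rw [htype c hc]
      exact lt_of_lt_of_le (Fin.is_lt _) hTy
  have hQ : ∀ c (hc : c < v.length) c' (hc' : c' < v.length)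
      (b : Fin (C.arity (I.clauses[c]'(hlc ▸ hc)).type))
      (b' : Fin (C.arity (I.clauses[c']'(hlc ▸ hc')).type)) (i j : Fin N),
      SameBits (q.2, fieldAddr R q c (i + N * b + 1), fieldAddr R q c' (j + N * b' + 1)) s ↔
        (I.clauses[c]'(hlc ▸ hc)).qudits (finProdFinEquiv (b, i)) =
          (I.clauses[c']'(hlc ▸ hc')).qudits (finProdFinEquiv (b', j)) := by
    intro c hc c' hc' b b' i j
    rw [sameBits_iff hwl ?_ ?_ (hbv c hc _ (hle _ b i)) (hbv c' hc' _ (hle _ b' j)), hqud c hc,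
      hqud c' hc']
    · exact Fin.val_inj
    · rw [hqud c hc]
      exact (Fin.is_lt _).trans hn
    · rw [hqud c' hc']
      exact (Fin.is_lt _).trans hn
  constructor
  · rintro ⟨c, _, c', _, ⟨⟨τ, b⟩, ⟨τ', b'⟩, i, j, k⟩, ⟨hc, hc'⟩, ⟨h1, h2⟩, h3, h4⟩ hno
    rw [hcnt] at hc hc'
    obtain rfl := (hT c hc τ).1 h1
    obtain rfl := (hT c' hc' τ').1 h2
    exact h4 ((hQ c hc c' hc' b b' k k).2 (hno _ (List.getElem_mem _) _ (List.getElem_mem _) b b'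
      i j k ((hQ c hc c' hc' b b' i j).1 h3)))
  · intro h
    unfold NoOverlap at h
    push Not at h
    obtain ⟨x, hx, x', hx', b, b', i, j, k, h1, h2⟩ := h
    obtain ⟨c, hc, rfl⟩ := List.mem_iff_getElem.1 hx
    obtain ⟨c', hc', rfl⟩ := List.mem_iff_getElem.1 hx'
    rw [hlc] at hc hc'
    exact ⟨c, by omega, c', by omega, ⟨⟨_, b⟩, ⟨_, b'⟩, i, j, k⟩, ⟨hcnt ▸ hc, hcnt ▸ hc'⟩,
      ⟨(hT c hc _).2 rfl, (hT c' hc' _).2 rfl⟩, (hQ c hc c' hc' b b' i j).2 h1,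
      fun h => h2 ((hQ c hc c' hc' b b' k k).1 h)⟩

/-- The integer of a clause of qubits that integer `j` of the clause of qudits is copied from. -/
def decodeIdx (N j : ℕ) : ℕ := if j = 0 then 0 else (j - 1) * N + 1

/-- A qudit is named by the first qubit of its block, so its number is already present among the
integers of the qubit clause. -/
theorem describes_decode (hN : 0 < N) {n : ℕ} {p : Fin n → Prop} (B : {x // p x} × Fin N ↪ Fin n)
    (hB : ∀ x, B (x, ⟨0, hN⟩) = x) (c : Σ i, Fin (C.arity i) ↪ {x // p x}) {r : ℕ → ℕ}
    (h : (C.encoded hV hP).Describes (blockClause hV hP B c) r) :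
    C.Describes (placedClause (Function.Embedding.subtype p) c) fun j => r (decodeIdx N j) := by
  obtain ⟨i, e⟩ := c
  refine ⟨h.1, ?_⟩
  show ∀ b : Fin (C.arity i), r (decodeIdx N (b + 1)) = ((e b : Fin n) : ℕ)
  intro b
  have h1 : ∀ t : Fin (C.arity i * N), r (t + 1) = (blockEmb e B t : Fin n) := h.2
  have h2 := h1 (finProdFinEquiv (b, ⟨0, hN⟩))
  rw [blockEmb_apply, hB, finProdFinEquiv_apply_val] at h2
  rw [← h2, decodeIdx, if_neg (Nat.succ_ne_zero _), Nat.add_sub_cancel, Nat.zero_add,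
    Nat.mul_comm]

theorem exists_reduces_decoded (hd : 0 < d) (hN : 0 < N) {δ : ℝ} (hδ : 0 < δ)
    (hPδ : ∀ i, (δ : ℂ) • C.op i ≤ P i ∧ (δ : ℂ) • P i ≤ C.op i)
    (hrigid : ∀ (n : ℕ) (e₁ e₂ : Fin N ↪ Fin n), (∃ i j, e₁ i = e₂ j) → e₁ ≠ e₂ →
        ∀ ψ : QuditVec 2 n, applyAt e₁ (1 - V * Vᴴ) *ᵥ ψ = 0 →
          applyAt e₂ (1 - V * Vᴴ) *ᵥ ψ = 0 → ψ = 0)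
    {I₀ : C.Instance} (hI₀ : ¬ I₀.Satisfiable) :
    ∃ g, IsAC0 g ∧ Reduces g (C.encoded hV hP) C := by
  obtain ⟨s₀, hs₀⟩ := C.exists_encodes I₀
  obtain ⟨ε₀, hε₀, hε₀1, hv₀⟩ := Instance.exists_violatedBy hI₀
  obtain ⟨R, hR⟩ : ∃ R, C.maxArity = R := ⟨_, rfl⟩
  have hR' : (C.encoded hV hP).maxArity = C.maxArity * N := maxArity_encoded hV hP
  -- The output has room both for the fixed unsatisfiable instance, encoded by `s₀`, and for a copy
  -- of part of the input; the overlap test selects between them.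
  obtain ⟨g, hg, hgT⟩ := exists_isAC0_of_template (fun n => n + s₀.length)
    (Polynomial.X + Polynomial.C s₀.length) (by simp)
    (fun c n q => if c = true then
        List.replicate (n + s₀.length - s₀.length) (Sum.inl false) ++ s₀.map Sum.inl
      else outTemplate (n + s₀.length) q.2 R (clauseCount (C.maxArity * N) n q)
        (fun t => Sum.inr (q.1 + q.2 + 1 + t))
        (fun c j t => Sum.inr (fieldAddr (C.maxArity * N) q c (decodeIdx N j) + t)))
    (ac0Family_hasOverlap C N)
  refine ⟨g, hg, min δ ε₀, lt_min hδ hε₀, fun s I hs => ?_⟩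
  obtain ⟨q, v, hw, hn, hTy, hv, hh, hlen, hcnt, hbn, hbv⟩ := hs.parse
  rw [hR'] at hlen hcnt hbv
  have hTy' : C.numTypes ≤ 2 ^ q.2 := hTy
  have hwv : v.length ≤ v.length * ((C.maxArity * N + 1) * q.2) :=
    Nat.le_mul_of_pos_right _ (Nat.mul_pos (Nat.succ_pos _) hw)
  have hov := hasOverlap_iff hV hP hn hTy' hv (by omega) hcnt hbv
  by_cases hno : NoOverlap hV hP I.clauses
  · have hcopy := hgT s q false hh (by rw [hov]; simp [hno])
    rw [if_neg Bool.false_ne_true] at hcopy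
    replace hcopy := hcopy (length_outTemplate (by
      rw [hcnt, hlen]
      have h1 : (R + 1) * q.2 ≤ (C.maxArity * N + 1) * q.2 := by
        refine Nat.mul_le_mul_right _ (Nat.succ_le_succ ?_)
        rw [← hR]
        exact Nat.le_mul_of_pos_right _ hN
      have h2 := Nat.mul_le_mul_left v.length h1
      omega) _ _)
    obtain ⟨p, B, L, hB, hI⟩ := exists_blocks_of_noOverlap hV hP hN hno
    set l := Function.Embedding.subtype p with hl
    classical
    -- The number of sites is unchanged; those that are not first qubits of a block occur in no
    -- clause.
    refine ⟨⟨I.n, L.map (placedClause l)⟩, ?_, ?_, fun ε hε hε1 h => ?_⟩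
    · rw [hcopy, hcnt, ← hR]
      have hv' : List.Forall₂ C.Describes (L.map (placedClause l))
          ((List.range v.length).map fun c => (fun (r : ℕ → ℕ) j => r (decodeIdx N j))
            (v.getD c fun _ => 0)) := by
        have h1 := map_range_getD v (fun _ => 0) fun (r : ℕ → ℕ) j => r (decodeIdx N j)
        refine Eq.mpr (congrArg _ h1) ?_
        have h2 : List.Forall₂ (C.encoded hV hP).Describes (L.map (blockClause hV hP B)) v := by
          have h3 := congrArg (fun J : (C.encoded hV hP).Instance =>
            List.Forall₂ (C.encoded hV hP).Describes J.clauses v) hI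
          exact h3.mp hv
        rw [List.forall₂_map_left_iff] at h2
        exact List.forall₂_map_left_iff.2 (List.forall₂_map_right_iff.2
          (h2.imp fun c r h => describes_decode hV hP hN B hB c h))
      refine encodes_outTemplate (I := ⟨I.n, L.map (placedClause l)⟩) (s := s)
        (hdr := fun t => Sum.inr (q.1 + q.2 + 1 + t)) (fld := fun c j t =>
          Sum.inr (fieldAddr (C.maxArity * N) q c (decodeIdx N j) + t)) _ hw hn hTy' _ hv'
        (fun t ht => hbn t ht) (fun c hc j hj t ht => hbv c hc _ ?_ t ht)
      unfold decodeIdx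
      split_ifs with hj0
      · exact Nat.zero_le _
      · have h4 : (j - 1 + 1) * N ≤ C.maxArity * N := Nat.mul_le_mul_right N (by omega)
        rw [Nat.add_mul, Nat.one_mul] at h4
        omega
    · have := satisfiable_block_iff hV hP l B L hδ hPδ hd
      rwa [← hI] at this
    · have hb : (⟨I.n, L.map (blockClause hV hP B)⟩ : (C.encoded hV hP).Instance).ViolatedBy ε := by
        rw [← hI]
        exact h
      exact (violatedBy_placed_of_block hV hP l B L hδ hPδ hd hb).mono
        (mul_le_mul_of_nonneg_right (min_le_left _ _) hε.le)
  · have hcopy := hgT s q true hh (by rw [hov]; simp [hno])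
    rw [if_pos rfl] at hcopy
    replace hcopy := hcopy (by simp)
    -- The violation of `I₀` is a constant `ε₀`, which suffices because `ε ≤ 1`.
    refine ⟨I₀, ?_, ?_, fun ε hε hε1 h => hv₀.mono ?_⟩
    · rw [hcopy, List.map_append, List.map_map, List.map_replicate]
      have h1 : (outBit s ∘ Sum.inl : Bool → Bool) = id := rfl
      rw [h1, List.map_id]
      exact hs₀.pad _
    · exact iff_of_false (fun h => hno (noOverlap_of_satisfiable hV hP hrigid h)) hI₀
    · calc min δ ε₀ * ε ≤ ε₀ * 1 :=
          mul_le_mul (min_le_right _ _) hε1 hε.le hε₀.le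
        _ = ε₀ := mul_one _

end Decode

/-! ### Problems without unsatisfiable instances -/

/-- The problem without clause types. -/
def empty (d : ℕ) : QCSP d where
  numTypes := 0
  arity := Fin.elim0
  op i := i.elim0
  posSemidef i := i.elim0

theorem empty_satisfiable (I : (empty 2).Instance) : I.Satisfiable := by
  refine ⟨fun x => if x = 0 then 1 else 0, ?_, fun c _ => c.type.elim0⟩
  simp [dotProduct]

/-- A constant map to a satisfiable instance works, the promise being vacuous. -/
theorem exists_reduces_of_satisfiable {d' : ℕ} {C : QCSP d} {C' : QCSP d'}
    (h : ∀ I : C.Instance, I.Satisfiable) (h' : ∃ I' : C'.Instance, I'.Satisfiable) :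
    ∃ f, IsAC0 f ∧ Reduces f C C' := by
  obtain ⟨I', hI'⟩ := h'
  obtain ⟨t, ht⟩ := C'.exists_encodes I'
  exact ⟨fun _ => t, isAC0_const t, 1, one_pos, fun s I _ => ⟨I', ht, iff_of_true (h I) hI',
    fun ε hε _ hv => absurd hv (Instance.not_violatedBy (h I) hε)⟩⟩

end QCSP

theorem mainTheorem5 (d : ℕ) (hd : 2 ≤ d) (C : QCSP d) :
    ∃ C' : QCSP 2, C'.IsProjective ∧
      (∀ k : ℕ, C.IsLocal k → C'.IsLocal (4 * 2 ^ Nat.clog 2 (Nat.clog 2 d) * k)) ∧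
      (∃ f : List Bool → List Bool, IsAC0 f ∧ QCSP.Reduces f C C') ∧
      (∃ g : List Bool → List Bool, IsAC0 g ∧ QCSP.Reduces g C' C) := by
  by_cases hC : ∀ I : C.Instance, I.Satisfiable
  · refine ⟨QCSP.empty 2, fun i => i.elim0, fun k _ i => i.elim0,
      QCSP.exists_reduces_of_satisfiable hC ⟨⟨0, []⟩, QCSP.empty_satisfiable _⟩,
      QCSP.exists_reduces_of_satisfiable QCSP.empty_satisfiable ⟨⟨0, []⟩, hC _⟩⟩
  · push Not at hC
    obtain ⟨I₀, hI₀⟩ := hC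
    -- The block length is a power of two, for the sake of addresses, and leaves at least `Nat.clog
    -- 2 d` qubits besides the two reserved by the overlap codes.
    set l := 2 + Nat.clog 2 (Nat.clog 2 d) with hl
    obtain ⟨N, hN⟩ : ∃ N, N = 2 ^ l := ⟨_, rfl⟩
    have hN4 : N = 4 * 2 ^ Nat.clog 2 (Nat.clog 2 d) := by rw [hN, hl, pow_add]; rfl
    have h1 : 1 ≤ 2 ^ Nat.clog 2 (Nat.clog 2 d) := Nat.one_le_two_pow
    have h2 : d ≤ 2 ^ (N - 2) := by
      have h3 : d ≤ 2 ^ Nat.clog 2 d := Nat.le_pow_clog one_lt_two d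
      have h4 : Nat.clog 2 d ≤ 2 ^ Nat.clog 2 (Nat.clog 2 d) := Nat.le_pow_clog one_lt_two _
      exact h3.trans (Nat.pow_le_pow_right two_pos (by omega))
    obtain ⟨V, hV, hrigid⟩ := exists_rigid_code (by omega : 2 ≤ N) h2
    obtain ⟨P, hP, δ, hδ, hPδ⟩ := C.exists_rangeProjs
    refine ⟨C.encoded hV hP, QCSP.encoded_isProjective hV hP, fun k hk i => ?_,
      QCSP.exists_reduces_encoded hV hP hδ hPδ (by omega) hN,
      QCSP.exists_reduces_decoded hV hP (by omega) (by omega) hδ hPδ hrigid hI₀⟩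
    rw [← hN4, Nat.mul_comm]
    exact Nat.mul_le_mul_right N (hk i)
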